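/- Let $\mathbb{F}_q$ be a finite field, let $n\le m$, and let $\mathcal{C}$ be an $\mathbb{F}_q$-linear subspace of the space $\mathbb{F}_q^{n\times m}$ of $n\times m$ matrices, with $\{0\}\neq\mathcal{C}\neq\mathbb{F}_q^{n\times m}$ and $t=\dim\mathcal{C}$. Definitions. The minimum distance is $d(\mathcal{C})=\min\{\operatorname{rank}A: A\in\mathcal{C},\ A\ne0\}$, and $d=d(\mathcal{C})$. The dual code is $\mathcal{C}^\perp=\{B\in\mathbb{F}_q^{n\times m}:\operatorname{Tr}(BA^{\mathsf T})=0\text{ for all }A\in\mathcal{C}\}$. The rank defect of a code $\mathcal{D}$ is $\mathrm{rdef}(\mathcal{D})=n-\lceil\dim(\mathcal{D})/m\rceil+1-d(\mathcal{D})$. A code $\mathcal{D}$ is AMRD if $\mathrm{rdef}(\mathcal{D})=1$, and dually AMRD if $\mathrm{rdef}(\mathcal{D})=\mathrm{rdef}(\mathcal{D}^\perp)=1$. For a subspace $\mathcal{A}\le\mathbb{F}_q^{n\times m}$ let $\mathrm{maxrk}(\mathcal{A})=\max\{\operatorname{rank}M:M\in\mathcal{A}\}$; $\mathcal{A}$ is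 an optimal anticode if $\dim\mathcal{A}=m\cdot\mathrm{maxrk}(\mathcal{A})$. For $1\le r\le t$ the $r$-th generalized weight of $\mathcal{C}$ is $$a_r(\mathcal{C})=\min\{\mathrm{maxrk}(\mathcal{A}):\mathcal{A}\text{ is an optimal anticode with }\dim(\mathcal{C}\cap\mathcal{A})\ge r\}.$$ Theorem. Assume $m\mid t$. 1. Suppose $a_{1+(\lceil t/m\rceil-1)m}(\mathcal{C})=n$. If $\mathrm{rdef}(\mathcal{C})\ge1$, then $\mathcal{C}^\perp$ is AMRD if and only if $a_{1+m}(\mathcal{C})=d+\mathrm{rdef}(\mathcal{C})+1$. Consequently, if $\mathcal{C}$ is AMRD, then $\mathcal{C}$ is dually AMRD if and only if $a_{1+m}(\mathcal{C})=d+2$. (In both cases $t/m\ge2$, so that $a_{1+m}(\mathcal{C})$ is defined.) 2. If $a_{1+(\lceil t/m\rceil-1)m}(\mathcal{C})<n$, then $\mathcal{C}^\perp$ is AMRD if and only if $\lceil t/m\rceil=1$. Moreover, without assuming this inequality: $\mathcal{C}$ is dually AMRD with $t/m=1$ if and only if $a_{1+(\lceil t/m\rceil-1)m}(\mathcal{C})<n$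 and $d=n-1$. -/

import Mathlib

noncomputable section

namespace RankMetric

variable {F : Type*} [Field F] {n m : ℕ}

/-- An `F`-linear rank-metric code: a linear subspace of the space of `n × m` matrices. -/
abbrev Code (F : Type*) [Field F] (n m : ℕ) : Type _ :=
  Submodule F (Matrix (Fin n) (Fin m) F)

/-- The minimum distance `min {rank A : A ∈ C, A ≠ 0}` of a code `C ≠ {0}`. -/
def minDist (C : Code F n m) : ℕ :=
  sInf {r : ℕ | ∃ A ∈ C, A ≠ 0 ∧ A.rank = r}

/-- The dual code `{B : Tr (B Aᵗ) = 0 for all A ∈ C}`. -/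
def dual (C : Code F n m) : Code F n m where
  carrier := {B | ∀ A ∈ C, Matrix.trace (B * A.transpose) = 0}
  zero_mem' := by
    intro A _
    simp
  add_mem' := by
    intro B B' hB hB' A hA
    simp [Matrix.add_mul, hB A hA, hB' A hA]
  smul_mem' := by
    intro c B hB A hA
    simp [hB A hA]

/-- The rank defect `n - ⌈t / m⌉ + 1 - d`, where `t = dim C` and `d` is the minimum distance. -/
def rdef (C : Code F n m) : ℤ :=
  (n : ℤ) - ⌈(Module.finrank F C : ℚ) / (m : ℚ)⌉ + 1 - (minDist C : ℤ)

/-- `C` is `s`-almost MRD. -/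
def IsAlmostMRD (s : ℤ) (C : Code F n m) : Prop := rdef C = s

/-- `C` is AMRD: its rank defect is one. -/
def IsAMRD (C : Code F n m) : Prop := IsAlmostMRD 1 C

/-- `C` is dually AMRD: both `C` and its dual have rank defect one. -/
def IsDuallyAMRD (C : Code F n m) : Prop := rdef C = 1 ∧ rdef (dual C) = 1

/-- The maximum rank of a matrix in `A`; the set of ranks is nonempty and bounded by `n`. -/
def maxrk (A : Code F n m) : ℕ :=
  sSup {r : ℕ | ∃ M ∈ A, M.rank = r}

/-- Optimal anticodes: `dim A = m · maxrk A`. -/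
def IsOptimalAnticode (A : Code F n m) : Prop :=
  Module.finrank F A = m * maxrk A

/-- The `r`-th generalized weight of `C`, for `1 ≤ r ≤ dim C`: the least `maxrk A` over the
optimal anticodes `A` with `dim (C ∩ A) ≥ r`. -/
def genWeight (C : Code F n m) (r : ℕ) : ℕ :=
  sInf {k : ℕ | ∃ A : Code F n m,
    IsOptimalAnticode A ∧ r ≤ Module.finrank F (C ⊓ A : Code F n m) ∧ maxrk A = k}

end RankMetric

end

set_option linter.unusedSectionVars false

/-! Write t = km, and let d' be the minimum distance of the dual code. Then rdef(C) = n - k + 1 - d.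
The dual has dimension (n - k)m, so its defect is k + 1 - d', and it is AMRD exactly when d' = k.
Everything follows from one equivalence, `minDist_dual_le_iff`: for 1 ≤ s ≤ k, d' ≤ s if and only if
a_{1+(k-s)m}(C) ≤ n - s. For s = 1 it compares a_{1+(k-1)m}(C) with n. For s = k it says that d' ≤ k
if and only if d ≤ n - k, that is, rdef(C) ≥ 1. For s = k - 1 it says that d' < k if and only if
a_{1+m}(C) < n - k + 2. Since n - k + 2 = d + rdef(C) + 1 is an upper bound for a_{1+m}(C)
(`genWeight_le_of_finrank_eq`), d' = k becomes an equality.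

The equivalence is a dimension count, once the dual of an optimal anticode of maximal rank u is
known to be an optimal anticode of maximal rank n - u, and optimal anticodes are known to extend to
every larger maximal rank. Both are evident for the space of matrices with column space in a fixed
U, so the real work is the classification: every optimal anticode has this form or, when n = m, is
the transpose of one.

The classification is proved by counting over the finite field. Averaging intersections with
Gabidulin codes shows that the rank distribution of an optimal space depends only on its maximal
rank v (`card_filter_rk_eq`), so the space contains as many rank-one maps as Hom(M, U) with dim U =
v. If it contained no full family of rank-one maps with a common image line or, in the square case,
a common kernel, it would have too few of them (`IsOptimal.exists_smulRight_mem`). Dividing by all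
full image lines then identifies the space (`IsOptimal.eq_homInto_fullVectors`). -/

namespace RankMetric

open Module Submodule

/-! ### Spaces of bounded rank against chains of MRD codes. -/

section LinearMaps

variable {F : Type*} [Field F] {M N : Type*} [AddCommGroup M] [Module F M]
  [AddCommGroup N] [Module F N]

/-- The rank of a linear map. -/
noncomputable abbrev rk (A : M →ₗ[F] N) : ℕ := finrank F (LinearMap.range A)

/-- The linear maps `M → N` with range in the subspace `U`. -/
def homInto (M : Type*) [AddCommGroup M] [Module F M] (U : Submodule F N) :
    Submodule F (M →ₗ[F] N) where
  carrier := {A | ∀ x, A x ∈ U}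
  zero_mem' := fun _ => U.zero_mem
  add_mem' := fun hA hB x => U.add_mem (hA x) (hB x)
  smul_mem' := fun c _ hA x => U.smul_mem c (hA x)

theorem mem_homInto {U : Submodule F N} {A : M →ₗ[F] N} :
    A ∈ homInto M U ↔ ∀ x, A x ∈ U := Iff.rfl

theorem mem_homInto_iff_range_le {U : Submodule F N} {A : M →ₗ[F] N} :
    A ∈ homInto M U ↔ LinearMap.range A ≤ U := by
  rw [mem_homInto, LinearMap.range_le_iff_comap, Submodule.eq_top_iff']
  rfl

theorem homInto_eq_range (U : Submodule F N) :
    homInto M U = LinearMap.range (LinearMap.compRight F (M := M) U.subtype) := by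
  ext A
  constructor
  · intro h
    exact ⟨A.codRestrict U h, by ext x; rfl⟩
  · rintro ⟨B, rfl⟩ x
    exact (B x).2

variable [FiniteDimensional F M] [FiniteDimensional F N]

theorem finrank_homInto (U : Submodule F N) :
    finrank F (homInto M U) = finrank F M * finrank F U := by
  rw [homInto_eq_range, LinearMap.finrank_range_of_inj, Module.finrank_linearMap]
  intro A B h
  ext x
  exact congrArg (fun f : M →ₗ[F] N => f x) h

theorem rk_le_of_mem_homInto {U : Submodule F N} {A : M →ₗ[F] N} (h : A ∈ homInto M U) :
    rk A ≤ finrank F U :=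
  Submodule.finrank_mono (mem_homInto_iff_range_le.1 h)

theorem rk_eq_zero_iff {A : M →ₗ[F] N} : rk A = 0 ↔ A = 0 := by
  rw [rk, Submodule.finrank_eq_zero, LinearMap.range_eq_bot]

/-- A space of linear maps of rank at most `v` of the largest possible dimension `v · dim M`. -/
structure IsOptimal (B : Submodule F (M →ₗ[F] N)) (v : ℕ) : Prop where
  rk_le : ∀ A ∈ B, rk A ≤ v
  le : v ≤ finrank F N
  finrank_eq : finrank F B = finrank F M * v

theorem isOptimal_homInto (U : Submodule F N) : IsOptimal (homInto M U) (finrank F U) :=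
  ⟨fun _ => rk_le_of_mem_homInto, Submodule.finrank_le U, finrank_homInto U⟩

theorem exists_finrank_eq_of_le_of_le {U W : Submodule F N} (hUW : U ≤ W) {k : ℕ}
    (hU : finrank F U ≤ k) (hW : k ≤ finrank F W) :
    ∃ V : Submodule F N, U ≤ V ∧ V ≤ W ∧ finrank F V = k := by
  induction k, hU using Nat.le_induction with
  | base => exact ⟨U, le_rfl, hUW, rfl⟩
  | succ k _ ih =>
    obtain ⟨V, hUV, hVW, hV⟩ := ih (by omega)
    obtain ⟨x, hxW, hxV⟩ : ∃ x ∈ W, x ∉ V := by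
      by_contra! h
      have := Submodule.finrank_mono (show W ≤ V from h)
      omega
    refine ⟨V ⊔ F ∙ x, hUV.trans le_sup_left,
      sup_le hVW ((Submodule.span_singleton_le_iff_mem x W).2 hxW), ?_⟩
    have h1 := Submodule.finrank_sup_add_finrank_inf_eq V (F ∙ x)
    have h2 : V ⊓ F ∙ x = ⊥ := by
      rw [← disjoint_iff, Submodule.disjoint_span_singleton' (by rintro rfl; simp at hxV)]
      exact hxV
    rw [h2, finrank_bot, finrank_span_singleton (by rintro rfl; simp at hxV)] at h1
    omega

theorem exists_isOptimal {v : ℕ} (hv : v ≤ finrank F N) :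
    ∃ U : Submodule F N, finrank F U = v ∧ IsOptimal (homInto M U) v := by
  obtain ⟨U, -, -, hU⟩ := exists_finrank_eq_of_le_of_le (bot_le : (⊥ : Submodule F N) ≤ ⊤)
    (k := v) (by simp) (by simpa using hv)
  exact ⟨U, hU, hU ▸ isOptimal_homInto U⟩

/-- A nested chain of maximum rank distance codes, one for every dimension. -/
structure IsMRDChain (D : ℕ → Submodule F (M →ₗ[F] N)) : Prop where
  mono : Monotone D
  finrank_eq : ∀ k ≤ finrank F N, finrank F (D k) = finrank F M * k
  lt_rk : ∀ k ≤ finrank F N, ∀ A ∈ D k, A ≠ 0 → finrank F N < rk A + k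

theorem IsMRDChain.disjoint {D : ℕ → Submodule F (M →ₗ[F] N)} (hD : IsMRDChain D)
    {B : Submodule F (M →ₗ[F] N)} {v : ℕ} (hB : ∀ A ∈ B, rk A ≤ v) (hv : v ≤ finrank F N) :
    B ⊓ D (finrank F N - v) = ⊥ := by
  rw [Submodule.eq_bot_iff]
  intro A hA
  by_contra h
  have h1 := hD.lt_rk _ (Nat.sub_le _ _) A hA.2 h
  have h2 := hB A hA.1
  omega

/-- The MRD code whose nonzero elements have rank above v is a space of codimension v · dim M that
meets B trivially. -/
theorem IsMRDChain.finrank_le {D : ℕ → Submodule F (M →ₗ[F] N)} (hD : IsMRDChain D)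
    {B : Submodule F (M →ₗ[F] N)} {v : ℕ} (hB : ∀ A ∈ B, rk A ≤ v) (hv : v ≤ finrank F N) :
    finrank F B ≤ finrank F M * v := by
  have h1 := Submodule.finrank_sup_add_finrank_inf_eq B (D (finrank F N - v))
  rw [hD.disjoint hB hv, hD.finrank_eq _ (Nat.sub_le _ _), finrank_bot] at h1
  have h2 := Submodule.finrank_le (B ⊔ D (finrank F N - v))
  rw [Module.finrank_linearMap] at h2
  have h3 : finrank F M * finrank F N
      = finrank F M * v + finrank F M * (finrank F N - v) := by
    rw [← mul_add, Nat.add_sub_cancel' hv]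
  omega

/-- The dimension formula gives the lower bound. For the upper bound, B ⊓ D k meets D (n - v)
trivially, where n = dim N, and both lie in D k; this is where the nesting of the chain is needed.
-/
theorem IsMRDChain.finrank_inf {D : ℕ → Submodule F (M →ₗ[F] N)} (hD : IsMRDChain D)
    {B : Submodule F (M →ₗ[F] N)} {v k : ℕ} (hB : IsOptimal B v)
    (hk : finrank F N ≤ v + k) (hkn : k ≤ finrank F N) :
    finrank F (B ⊓ D k : Submodule F (M →ₗ[F] N)) = finrank F M * (v + k - finrank F N) := by
  obtain ⟨e, he⟩ := Nat.exists_eq_add_of_le hk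
  have h1 := Submodule.finrank_sup_add_finrank_inf_eq B (D k)
  have h2 := Submodule.finrank_le (B ⊔ D k)
  rw [Module.finrank_linearMap] at h2
  rw [hB.finrank_eq, hD.finrank_eq k hkn, ← mul_add, he, mul_add] at h1
  have h3 := Submodule.finrank_sup_add_finrank_inf_eq (B ⊓ D k) (D (finrank F N - v))
  have h4 : (B ⊓ D k) ⊓ D (finrank F N - v) = ⊥ := by
    rw [eq_bot_iff, ← hD.disjoint hB.rk_le hB.le]
    exact inf_le_inf_right _ inf_le_left
  rw [h4, hD.finrank_eq _ (Nat.sub_le _ _), finrank_bot] at h3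
  have h5 : finrank F ↥(B ⊓ D k ⊔ D (finrank F N - v)) ≤ finrank F (D k) :=
    Submodule.finrank_mono (sup_le inf_le_right (hD.mono (by omega)))
  rw [hD.finrank_eq k hkn] at h5
  have h6 : finrank F M * k = finrank F M * e + finrank F M * (finrank F N - v) := by
    rw [← mul_add]
    congr 1
    have := hB.le
    omega
  rw [he, Nat.add_sub_cancel_left]
  omega

/-- An MRD code contains a map of the smallest rank that its minimum distance allows. -/
theorem IsMRDChain.exists_rk_eq {D : ℕ → Submodule F (M →ₗ[F] N)} (hD : IsMRDChain D)
    {i : ℕ} (hi : 1 ≤ i) (hin : i ≤ finrank F N) (hM : 0 < finrank F M) :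
    ∃ A ∈ D (finrank F N + 1 - i), rk A = i := by
  obtain ⟨U, hU, hopt⟩ := exists_isOptimal (M := M) hin
  have h := hD.finrank_inf hopt (k := finrank F N + 1 - i) (by omega) (by omega)
  have h1 : i + (finrank F N + 1 - i) - finrank F N = 1 := by omega
  rw [h1, mul_one] at h
  obtain ⟨A, hA, hA0⟩ := Submodule.exists_mem_ne_zero_of_ne_bot
    (p := homInto M U ⊓ D (finrank F N + 1 - i)) (by
      intro hb
      rw [hb, finrank_bot] at h
      omega)
  refine ⟨A, hA.2, le_antisymm (hopt.rk_le A hA.1) ?_⟩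
  have := hD.lt_rk _ (by omega) A hA.2 hA0
  omega

end LinearMaps

/-! ### Gabidulin codes, and existence of MRD chains. -/

section Gabidulin

variable {F : Type*} [Field F] [Finite F] {L : Type*} [Field L] [Algebra F L]
  {E : Type*} [AddCommGroup E] [Module F E] [FiniteDimensional F E]

/-- The `i`-th power of the Frobenius endomorphism, restricted along `ι`. -/
noncomputable def frobComp (ι : E →ₗ[F] L) (i : ℕ) : E →ₗ[F] L :=
  letI := Fintype.ofFinite F
  ((FiniteField.frobeniusAlgHom F L) ^ i).toLinearMap ∘ₗ ι

theorem frobComp_apply (ι : E →ₗ[F] L) (i : ℕ) (x : E) :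
    frobComp ι i x = ι x ^ (Nat.card F ^ i) := by
  let _ := Fintype.ofFinite F
  rw [frobComp, Nat.card_eq_fintype_card]
  simp [AlgHom.coe_pow, FiniteField.coe_frobeniusAlgHom, pow_iterate]

/-- The kernel embeds into the root set of a nonzero linearized polynomial of degree at most
q^(k-1), so it has at most q^(k-1) elements. -/
theorem finrank_ker_sum_frobComp_lt {ι : E →ₗ[F] L} (hι : Function.Injective ι) {k : ℕ}
    (a : Fin k → L) (ha : a ≠ 0) :
    finrank F (LinearMap.ker (∑ i, a i • frobComp ι i)) < k := by
  classical
  let q := Nat.card F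
  have hq : 1 < q := Finite.one_lt_card
  let p : Polynomial L := ∑ i, Polynomial.C (a i) * Polynomial.X ^ (q ^ (i : ℕ))
  have hp : p ≠ 0 := by
    obtain ⟨j, hj⟩ := Function.ne_iff.1 ha
    intro h
    apply hj
    have : p.coeff (q ^ (j : ℕ)) = a j := by
      simp only [p, Polynomial.finsetSum_coeff, Polynomial.coeff_C_mul, Polynomial.coeff_X_pow]
      rw [Finset.sum_eq_single j]
      · simp
      · intro i _ hij
        rw [if_neg, mul_zero]
        intro h
        exact hij (Fin.ext (Nat.pow_right_injective hq h.symm))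
      · simp
    rw [← this, h]
    rfl
  obtain ⟨l, rfl⟩ : ∃ l, k = l + 1 := by
    cases k with
    | zero => exact absurd (Subsingleton.elim _ _) ha
    | succ l => exact ⟨l, rfl⟩
  have hdeg : p.natDegree ≤ q ^ l := by
    refine Polynomial.natDegree_sum_le_of_forall_le _ _ fun i _ => ?_
    refine (Polynomial.natDegree_C_mul_X_pow_le _ _).trans ?_
    exact Nat.pow_le_pow_right hq.le (by omega)
  let K := LinearMap.ker (∑ i, a i • frobComp ι i)
  have hK : ∀ x : K, ι x ∈ p.roots.toFinset := by
    intro x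
    rw [Multiset.mem_toFinset, Polynomial.mem_roots hp, Polynomial.IsRoot.def]
    obtain ⟨x, hx⟩ := x
    rw [LinearMap.mem_ker, LinearMap.sum_apply] at hx
    simpa [p, Polynomial.eval_finsetSum, frobComp_apply] using hx
  have hcard : Nat.card K ≤ q ^ l := by
    calc Nat.card K ≤ Nat.card p.roots.toFinset :=
          Nat.card_le_card_of_injective (fun x => (⟨ι x, hK x⟩ : p.roots.toFinset))
            (fun x y h => Subtype.ext (hι (congrArg Subtype.val h)))
      _ = p.roots.toFinset.card := Nat.card_eq_card_toFinset _ |>.trans (by rw [Finset.toFinset_coe])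
      _ ≤ p.roots.card := Multiset.toFinset_card_le _
      _ ≤ p.natDegree := p.card_roots'
      _ ≤ q ^ l := hdeg
  rw [Module.natCard_eq_pow_finrank (K := F)] at hcard
  exact Nat.lt_succ_of_le ((Nat.pow_le_pow_iff_right hq).1 hcard)

/-- The Gabidulin code of the linearized polynomials with `k` coefficients. -/
noncomputable def gabidulin (ι : E →ₗ[F] L) (k : ℕ) : Submodule F (E →ₗ[F] L) :=
  (span L (frobComp ι '' Set.Iio k)).restrictScalars F

theorem gabidulin_mono (ι : E →ₗ[F] L) : Monotone (gabidulin ι) := fun _ _ h =>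
  span_mono (Set.image_mono (Set.Iio_subset_Iio h))

theorem image_Iio_eq_range (ι : E →ₗ[F] L) (k : ℕ) :
    frobComp ι '' Set.Iio k = Set.range fun i : Fin k => frobComp ι i := by
  ext A
  constructor
  · rintro ⟨i, hi, rfl⟩
    exact ⟨⟨i, hi⟩, rfl⟩
  · rintro ⟨i, rfl⟩
    exact ⟨i, i.2, rfl⟩

theorem finrank_lt_rk_add_of_mem_gabidulin {ι : E →ₗ[F] L} (hι : Function.Injective ι) {k : ℕ}
    {A : E →ₗ[F] L} (hA : A ∈ gabidulin ι k) (hA0 : A ≠ 0) : finrank F E < rk A + k := by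
  rw [gabidulin, restrictScalars_mem, image_Iio_eq_range, mem_span_range_iff_exists_fun] at hA
  obtain ⟨a, rfl⟩ := hA
  have h1 := finrank_ker_sum_frobComp_lt hι a (by rintro rfl; simp at hA0)
  have h2 := LinearMap.finrank_range_add_finrank_ker (∑ i, a i • frobComp ι i)
  simp only [rk]
  omega

theorem finrank_gabidulin [FiniteDimensional F L] {ι : E →ₗ[F] L} (hι : Function.Injective ι)
    {k : ℕ} (hk : k ≤ finrank F E) :
    finrank F (gabidulin ι k) = finrank F L * k := by
  have hli : LinearIndependent L fun i : Fin k => frobComp ι i := by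
    rw [Fintype.linearIndependent_iff]
    intro a ha
    by_contra h
    have h1 := finrank_ker_sum_frobComp_lt hι a (fun h' => h fun i => congrFun h' i)
    rw [ha, LinearMap.ker_zero, finrank_top] at h1
    omega
  have h2 := finrank_span_eq_card hli
  rw [← image_Iio_eq_range, Fintype.card_fin] at h2
  have := Module.Free.of_divisionRing L (span L (frobComp ι '' Set.Iio k))
  have h3 := Module.finrank_mul_finrank F L (span L (frobComp ι '' Set.Iio k))
  rw [h2] at h3
  exact h3.symm

variable {M N : Type*} [AddCommGroup M] [Module F M] [AddCommGroup N] [Module F N]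
  [FiniteDimensional F M] [FiniteDimensional F N]

theorem rk_dualMap (A : M →ₗ[F] N) : rk A.dualMap = rk A :=
  LinearMap.finrank_range_dualMap_eq_finrank_range A

variable {M' N' : Type*} [AddCommGroup M'] [Module F M'] [AddCommGroup N'] [Module F N']
  [FiniteDimensional F M'] [FiniteDimensional F N']

/-- Transposition of linear maps, with the dual spaces identified with `M'` and `N'`. -/
noncomputable def transposeMap (e : Dual F M ≃ₗ[F] M') (f : Dual F N ≃ₗ[F] N') :
    (M →ₗ[F] N) →ₗ[F] (N' →ₗ[F] M') where
  toFun A := e.toLinearMap ∘ₗ A.dualMap ∘ₗ f.symm.toLinearMap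
  map_add' A B := by
    ext x
    simp only [LinearMap.comp_apply, LinearMap.add_apply, LinearEquiv.coe_coe, ← map_add]
    congr 1
    ext y
    simp
  map_smul' c A := by
    ext x
    simp only [LinearMap.comp_apply, LinearMap.smul_apply, LinearEquiv.coe_coe, ← map_smul,
      RingHom.id_apply]
    congr 1
    ext y
    simp

theorem rk_transposeMap (e : Dual F M ≃ₗ[F] M') (f : Dual F N ≃ₗ[F] N') (A : M →ₗ[F] N) :
    rk (transposeMap e f A) = rk A := by
  rw [← rk_dualMap A]
  change finrank F (LinearMap.range (e.toLinearMap ∘ₗ (A.dualMap ∘ₗ f.symm.toLinearMap))) = _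
  rw [LinearMap.range_comp, LinearMap.range_comp_of_range_eq_top _ f.symm.range]
  exact LinearEquiv.finrank_map_eq e _

theorem transposeMap_injective (e : Dual F M ≃ₗ[F] M') (f : Dual F N ≃ₗ[F] N') :
    Function.Injective (transposeMap e f) := by
  rw [← LinearMap.ker_eq_bot, eq_bot_iff]
  intro A hA
  rw [LinearMap.mem_ker] at hA
  have := rk_transposeMap e f A
  rw [hA, rk_eq_zero_iff.2 rfl] at this
  exact rk_eq_zero_iff.1 this.symm

/-- Transposition of linear maps between finite-dimensional spaces. -/
noncomputable def transposeEquiv (e : Dual F M ≃ₗ[F] M') (f : Dual F N ≃ₗ[F] N') :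
    (M →ₗ[F] N) ≃ₗ[F] (N' →ₗ[F] M') :=
  LinearEquiv.ofInjectiveOfFinrankEq (transposeMap e f) (transposeMap_injective e f) (by
    rw [Module.finrank_linearMap, Module.finrank_linearMap, ← e.finrank_eq, ← f.finrank_eq,
      Subspace.dual_finrank_eq, Subspace.dual_finrank_eq, mul_comm])

theorem rk_transposeEquiv (e : Dual F M ≃ₗ[F] M') (f : Dual F N ≃ₗ[F] N') (A : M →ₗ[F] N) :
    rk (transposeEquiv e f A) = rk A := rk_transposeMap e f A

theorem exists_injective_of_finrank_le (h : finrank F M ≤ finrank F N) :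
    ∃ ι : M →ₗ[F] N, Function.Injective ι := by
  obtain ⟨U, -, -, hU⟩ := exists_finrank_eq_of_le_of_le (bot_le : (⊥ : Submodule F N) ≤ ⊤)
    (k := finrank F M) (by simp) (by simpa using h)
  exact ⟨U.subtype ∘ₗ (LinearEquiv.ofFinrankEq M U hU.symm).toLinearMap,
    U.injective_subtype.comp (LinearEquiv.injective _)⟩

-- Gabidulin codes in Hom(N, L), with L the extension of degree dim M, are spaces over L, which
-- makes their dimensions multiples of dim M. Transposition preserves rank and carries them into
-- Hom(M, N). The bound dim N ≤ dim M lets N embed into L.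
variable (F M N) in
theorem exists_isMRDChain (hM : 0 < finrank F M) (hNM : finrank F N ≤ finrank F M) :
    ∃ D : ℕ → Submodule F (M →ₗ[F] N), IsMRDChain D := by
  obtain ⟨p, _⟩ := CharP.exists F
  have : Fact p.Prime := ⟨CharP.char_is_prime F p⟩
  have : NeZero (finrank F M) := ⟨hM.ne'⟩
  let L := FiniteField.Extension F p (finrank F M)
  have hL : finrank F L = finrank F M := FiniteField.finrank_extension F p _
  let e : Dual F M ≃ₗ[F] L :=
    LinearEquiv.ofFinrankEq _ _ (Subspace.dual_finrank_eq.trans hL.symm)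
  obtain ⟨f⟩ : Nonempty (Dual F N ≃ₗ[F] N) :=
    ⟨LinearEquiv.ofFinrankEq _ _ Subspace.dual_finrank_eq⟩
  obtain ⟨ι, hι⟩ : ∃ ι : N →ₗ[F] L, Function.Injective ι :=
    exists_injective_of_finrank_le (by rwa [hL])
  let T := transposeEquiv e f
  refine ⟨fun k => (gabidulin ι k).comap T.toLinearMap, ?_, ?_, ?_⟩
  · exact fun k l h => comap_mono (gabidulin_mono ι h)
  · intro k hk
    have h := finrank_gabidulin hι (k := k) hk
    rw [hL] at h
    rw [← h, ← T.symm_symm, ← Submodule.map_equiv_eq_comap_symm T.symm]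
    exact LinearEquiv.finrank_map_eq T.symm _
  · intro k hk A hA hA0
    have := finrank_lt_rk_add_of_mem_gabidulin hι (A := T A) hA (by simpa using hA0)
    rwa [rk_transposeEquiv] at this

end Gabidulin

/-! ### Equivalence of linear maps of equal rank. -/

section Equivalence

variable {F : Type*} [Field F] {M N : Type*} [AddCommGroup M] [Module F M]
  [AddCommGroup N] [Module F N] [FiniteDimensional F M] [FiniteDimensional F N]

theorem rk_arrowCongr (e : M ≃ₗ[F] M) (f : N ≃ₗ[F] N) (A : M →ₗ[F] N) :
    rk (e.arrowCongr f A) = rk A := by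
  have : e.arrowCongr f A = f.toLinearMap ∘ₗ (A ∘ₗ e.symm.toLinearMap) := rfl
  rw [rk, this, LinearMap.range_comp, LinearMap.range_comp_of_range_eq_top _ e.symm.range]
  exact LinearEquiv.finrank_map_eq f _

theorem exists_comp_eq_of_range_eq {A B : M →ₗ[F] N}
    (h : LinearMap.range A = LinearMap.range B) :
    ∃ e : M ≃ₗ[F] M, ∀ x, B (e x) = A x := by
  have hker : finrank F (LinearMap.ker A) = finrank F (LinearMap.ker B) := by
    have h1 := LinearMap.finrank_range_add_finrank_ker A
    have h2 := LinearMap.finrank_range_add_finrank_ker B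
    rw [h] at h1
    omega
  let τ := LinearEquiv.ofFinrankEq _ _ hker
  obtain ⟨s, hs⟩ := B.rangeRestrict.exists_rightInverse_of_surjective B.range_rangeRestrict
  obtain ⟨p, hp⟩ := (LinearMap.ker A).subtype.exists_leftInverse_of_injective
    (LinearMap.ker A).ker_subtype
  let A' : M →ₗ[F] LinearMap.range B := A.codRestrict _ fun x => h ▸ LinearMap.mem_range_self A x
  -- The first summand sends x to a preimage of A x under B and kills ker A; the second maps ker A
  -- isomorphically onto ker B, which makes the sum injective.
  let e : M →ₗ[F] M := s ∘ₗ A' + (LinearMap.ker B).subtype ∘ₗ τ.toLinearMap ∘ₗ p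
  have hBe : ∀ x, B (e x) = A x := by
    intro x
    have h1 : B (s (A' x)) = A x :=
      congrArg Subtype.val (LinearMap.congr_fun hs (A' x))
    have h2 : B (τ (p x)) = 0 := (τ (p x)).2
    simp [e, h1, h2]
  have hinj : Function.Injective e := by
    rw [← LinearMap.ker_eq_bot, eq_bot_iff]
    intro x hx
    rw [LinearMap.mem_ker] at hx
    have hAx : A x = 0 := by rw [← hBe, hx, map_zero]
    have hA' : A' x = 0 := Subtype.ext hAx
    have hpx : p x = ⟨x, hAx⟩ := LinearMap.congr_fun hp ⟨x, hAx⟩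
    have h0 : (⟨x, hAx⟩ : LinearMap.ker A) = 0 := by simpa [e, hA', hpx] using hx
    exact congrArg Subtype.val h0
  exact ⟨LinearEquiv.ofInjectiveEndo e hinj, hBe⟩

/-- Linear maps of the same rank are equivalent. -/
theorem exists_arrowCongr_eq_of_rk_eq {A B : M →ₗ[F] N} (h : rk A = rk B) :
    ∃ (e : M ≃ₗ[F] M) (f : N ≃ₗ[F] N), e.arrowCongr f A = B := by
  obtain ⟨f, hf⟩ := Submodule.exists_linearEquiv_restrict_eq
    (LinearEquiv.ofFinrankEq (LinearMap.range A) (LinearMap.range B) h)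
  have hr : LinearMap.range B = LinearMap.range (f.toLinearMap ∘ₗ A) := by
    symm
    apply Submodule.eq_of_le_of_finrank_eq
    · rintro _ ⟨x, rfl⟩
      have := hf ⟨A x, LinearMap.mem_range_self A x⟩
      rw [LinearMap.comp_apply, LinearEquiv.coe_coe, ← this]
      exact Subtype.prop _
    · rw [LinearMap.range_comp]
      exact (LinearEquiv.finrank_map_eq f _).trans h
  obtain ⟨e, he⟩ := exists_comp_eq_of_range_eq hr
  refine ⟨e.symm, f, ?_⟩
  ext x
  exact he x

theorem IsOptimal.map_arrowCongr {B : Submodule F (M →ₗ[F] N)} {v : ℕ} (hB : IsOptimal B v)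
    (e : M ≃ₗ[F] M) (f : N ≃ₗ[F] N) : IsOptimal (B.map (e.arrowCongr f).toLinearMap) v := by
  refine ⟨?_, hB.le, ?_⟩
  · rintro _ ⟨A, hA, rfl⟩
    exact (rk_arrowCongr e f A).trans_le (hB.rk_le A hA)
  · rw [← hB.finrank_eq]
    exact LinearEquiv.finrank_map_eq _ _

end Equivalence

/-! ### The rank distribution of optimal spaces. -/

section RankDistribution

variable {F : Type*} [Field F] [Finite F] {M N : Type*} [AddCommGroup M] [Module F M]
  [AddCommGroup N] [Module F N] [FiniteDimensional F M] [FiniteDimensional F N]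

instance finite_of_finiteDimensional_linearMap : Finite (M →ₗ[F] N) :=
  Module.finite_of_finite F

instance finite_linearEquiv_of_finiteDimensional : Finite (M ≃ₗ[F] N) :=
  Finite.of_injective _ LinearEquiv.toLinearMap_injective

/-- The elements of a space of linear maps. -/
noncomputable def elems (B : Submodule F (M →ₗ[F] N)) : Finset (M →ₗ[F] N) :=
  (Set.toFinite (B : Set (M →ₗ[F] N))).toFinset

theorem mem_elems {B : Submodule F (M →ₗ[F] N)} {A : M →ₗ[F] N} : A ∈ elems B ↔ A ∈ B := by
  simp [elems]

theorem card_elems (B : Submodule F (M →ₗ[F] N)) :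
    (elems B).card = Nat.card F ^ finrank F B := by
  rw [elems, ← Set.ncard_eq_toFinset_card, ← Module.natCard_eq_pow_finrank]
  rfl

open Classical in
/-- The number of pairs of automorphisms that move `A` into `D`. -/
noncomputable def moveCount (D : Submodule F (M →ₗ[F] N)) (A : M →ₗ[F] N) : ℕ :=
  letI := Fintype.ofFinite ((M ≃ₗ[F] M) × (N ≃ₗ[F] N))
  (Finset.univ.filter fun g : (M ≃ₗ[F] M) × (N ≃ₗ[F] N) => g.1.arrowCongr g.2 A ∈ D).card

theorem moveCount_eq_of_rk_eq (D : Submodule F (M →ₗ[F] N)) {A B : M →ₗ[F] N}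
    (h : rk A = rk B) : moveCount D A = moveCount D B := by
  classical
  suffices H : ∀ {A B : M →ₗ[F] N}, rk A = rk B → moveCount D B ≤ moveCount D A from
    le_antisymm (H h.symm) (H h)
  intro A B h
  obtain ⟨e, f, rfl⟩ := exists_arrowCongr_eq_of_rk_eq h
  let _ := Fintype.ofFinite ((M ≃ₗ[F] M) × (N ≃ₗ[F] N))
  refine Finset.card_le_card_of_injOn (fun g => (e ≪≫ₗ g.1, f ≪≫ₗ g.2)) ?_ ?_
  · intro g hg
    simp only [Finset.coe_filter, Finset.mem_univ, true_and, Set.mem_ofPred_eq] at hg ⊢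
    exact hg
  · intro g _ g' _ h
    simp only [Prod.mk.injEq] at h
    refine Prod.ext ?_ ?_
    · ext x
      simpa using LinearEquiv.congr_fun h.1 (e.symm x)
    · ext x
      simpa using LinearEquiv.congr_fun h.2 (f.symm x)

theorem moveCount_pos {D : Submodule F (M →ₗ[F] N)} {A : M →ₗ[F] N} (h : A ∈ D) :
    0 < moveCount D A := by
  classical
  refine Finset.card_pos.2 ⟨(LinearEquiv.refl F M, LinearEquiv.refl F N), ?_⟩
  simp only [Finset.mem_filter, Finset.mem_univ, true_and]
  exact h

theorem moveCount_eq_zero {D : Submodule F (M →ₗ[F] N)} {A : M →ₗ[F] N}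
    (h : ∀ B ∈ D, rk B ≠ rk A) : moveCount D A = 0 := by
  classical
  refine Finset.card_eq_zero.2 (Finset.filter_eq_empty_iff.2 ?_)
  intro g _ hg
  exact h _ hg (rk_arrowCongr _ _ A)

/-- Double counting of the triples (A, e, f) for which (e, f) moves A into D k: every equivalent
copy of B is again optimal, so it meets D k in the same known dimension. -/
theorem IsMRDChain.sum_moveCount {D : ℕ → Submodule F (M →ₗ[F] N)} (hD : IsMRDChain D)
    {B : Submodule F (M →ₗ[F] N)} {v k : ℕ} (hB : IsOptimal B v)
    (hk : finrank F N ≤ v + k) (hkn : k ≤ finrank F N) :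
    ∑ A ∈ elems B, moveCount (D k) A = Nat.card ((M ≃ₗ[F] M) × (N ≃ₗ[F] N)) *
      Nat.card F ^ (finrank F M * (v + k - finrank F N)) := by
  classical
  let _ := Fintype.ofFinite ((M ≃ₗ[F] M) × (N ≃ₗ[F] N))
  have h1 : ∀ g : (M ≃ₗ[F] M) × (N ≃ₗ[F] N),
      ((elems B).filter fun A => g.1.arrowCongr g.2 A ∈ D k).card =
        Nat.card F ^ (finrank F M * (v + k - finrank F N)) := by
    intro g
    rw [← hD.finrank_inf (hB.map_arrowCongr g.1 g.2) hk hkn, ← card_elems]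
    refine Finset.card_bij (fun A _ => g.1.arrowCongr g.2 A) ?_ ?_ ?_
    · intro A hA
      rw [Finset.mem_filter, mem_elems] at hA
      exact mem_elems.2 ⟨⟨A, hA.1, rfl⟩, hA.2⟩
    · intro A _ A' _ h
      exact (g.1.arrowCongr g.2).injective h
    · intro A hA
      obtain ⟨⟨A', hA', rfl⟩, h⟩ := mem_elems.1 hA
      exact ⟨A', Finset.mem_filter.2 ⟨mem_elems.2 hA', h⟩, rfl⟩
  have h2 : ∀ A, moveCount (D k) A = ∑ g : (M ≃ₗ[F] M) × (N ≃ₗ[F] N),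
      if g.1.arrowCongr g.2 A ∈ D k then 1 else 0 := fun A => by
    rw [← Finset.card_filter]
    rfl
  simp_rw [h2]
  rw [Finset.sum_comm]
  simp_rw [← Finset.card_filter, h1]
  rw [Finset.sum_const, smul_eq_mul, Finset.card_univ,
    Nat.card_eq_fintype_card (α := (M ≃ₗ[F] M) × (N ≃ₗ[F] N))]

open Classical in
theorem sum_elems_eq_sum_rk {f : (M →ₗ[F] N) → ℕ} (hf : ∀ {A B}, rk A = rk B → f A = f B) :
    ∃ c : ℕ → ℕ, (∀ A, c (rk A) = f A) ∧ ∀ B : Submodule F (M →ₗ[F] N),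
      ∑ A ∈ elems B, f A =
        ∑ j ∈ Finset.range (finrank F N + 1), ((elems B).filter fun A => rk A = j).card * c j := by
  have hc : ∀ A, Function.extend (rk : (M →ₗ[F] N) → ℕ) f 0 (rk A) = f A :=
    Function.FactorsThrough.extend_apply (f := rk) (fun _ _ h => hf h) 0
  refine ⟨Function.extend rk f 0, hc, fun B => ?_⟩
  rw [← Finset.sum_fiberwise_of_maps_to (g := rk) (t := Finset.range (finrank F N + 1))]
  · refine Finset.sum_congr rfl fun j _ => ?_
    rw [Finset.sum_const_nat (m := Function.extend rk f 0 j)]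
    intro A hA
    rw [← (Finset.mem_filter.1 hA).2, hc]
  · intro A _
    exact Finset.mem_range_succ_iff.2 (Submodule.finrank_le _)

open Classical in
/-- Two optimal spaces of the same maximal rank have the same rank distribution. -/
theorem card_filter_rk_eq (hM : 0 < finrank F M) (hNM : finrank F N ≤ finrank F M)
    {B B' : Submodule F (M →ₗ[F] N)} {v : ℕ} (hB : IsOptimal B v) (hB' : IsOptimal B' v) (i : ℕ) :
    ((elems B).filter fun A => rk A = i).card = ((elems B').filter fun A => rk A = i).card := by
  obtain ⟨D, hD⟩ := exists_isMRDChain F M N hM hNM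
  have hzero : ∀ {B : Submodule F (M →ₗ[F] N)},
      ((elems B).filter fun A => rk A = 0) = {0} := by
    intro B
    ext A
    rw [Finset.mem_filter, mem_elems, rk_eq_zero_iff, Finset.mem_singleton]
    exact ⟨fun h => h.2, fun h => ⟨h ▸ B.zero_mem, h⟩⟩
  have hlarge : ∀ {B : Submodule F (M →ₗ[F] N)}, IsOptimal B v → ∀ i, v < i →
      ((elems B).filter fun A => rk A = i) = ∅ := by
    intro B hB i hi
    refine Finset.filter_eq_empty_iff.2 fun A hA h => ?_
    have := hB.rk_le A (mem_elems.1 hA)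
    omega
  -- Descending induction on the rank i.
  induction hd : v - i using Nat.strong_induction_on generalizing i with
  | _ d ih =>
  subst hd
  rcases Nat.eq_zero_or_pos i with rfl | hi
  · rw [hzero, hzero]
  by_cases hiv : v < i
  · rw [hlarge hB i hiv, hlarge hB' i hiv]
  rw [not_lt] at hiv
  have hiN := hiv.trans hB.le
  -- The nonzero maps in this MRD code have rank at least i, so ranks strictly between 0 and i have
  -- weight zero. Ranks above i are settled by induction, and rank i is the only unknown left. Its
  -- weight is positive because rank i occurs in the code.
  obtain ⟨c, hc, hsum⟩ := sum_elems_eq_sum_rk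
    (f := moveCount (D (finrank F N + 1 - i))) (fun h => moveCount_eq_of_rk_eq _ h)
  have h1 := (hD.sum_moveCount hB (k := finrank F N + 1 - i) (by omega) (by omega)).trans
    (hD.sum_moveCount hB' (by omega) (by omega)).symm
  have hmem : i ∈ Finset.range (finrank F N + 1) := Finset.mem_range_succ_iff.2 hiN
  rw [hsum, hsum, ← Finset.add_sum_erase _ _ hmem, ← Finset.add_sum_erase _ _ hmem] at h1
  have h2 : ∀ j ∈ (Finset.range (finrank F N + 1)).erase i,
      ((elems B).filter fun A => rk A = j).card * c j =
        ((elems B').filter fun A => rk A = j).card * c j := by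
    intro j hj
    rw [Finset.mem_erase, Finset.mem_range_succ_iff] at hj
    rcases lt_or_gt_of_ne hj.1 with hji | hij
    · rcases Nat.eq_zero_or_pos j with rfl | hj0
      · rw [hzero, hzero]
      · obtain ⟨A, -, hA⟩ := hD.exists_rk_eq hj0 hj.2 hM
        have : c j = 0 := by
          rw [← hA, hc]
          refine moveCount_eq_zero fun A' hA' h => ?_
          have h0 : A' ≠ 0 := fun h0 => by
            have := rk_eq_zero_iff.2 h0
            omega
          have := hD.lt_rk _ (by omega) A' hA' h0
          omega
        rw [this, mul_zero, mul_zero]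
    · by_cases hjv : v < j
      · rw [hlarge hB j hjv, hlarge hB' j hjv]
      · rw [ih (v - j) (by omega) j rfl]
  rw [Finset.sum_congr rfl h2] at h1
  have h3 := Nat.add_right_cancel h1
  refine Nat.eq_of_mul_eq_mul_right ?_ h3
  obtain ⟨A, hA, hrk⟩ := hD.exists_rk_eq hi hiN hM
  have h4 := hc A
  rw [hrk] at h4
  exact h4.symm ▸ moveCount_pos hA

theorem sum_elems_eq_of_isOptimal (hM : 0 < finrank F M) (hNM : finrank F N ≤ finrank F M)
    {B B' : Submodule F (M →ₗ[F] N)} {v : ℕ} (hB : IsOptimal B v) (hB' : IsOptimal B' v)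
    {f : (M →ₗ[F] N) → ℕ} (hf : ∀ {A B}, rk A = rk B → f A = f B) :
    ∑ A ∈ elems B, f A = ∑ A ∈ elems B', f A := by
  classical
  obtain ⟨c, -, hsum⟩ := sum_elems_eq_sum_rk hf
  rw [hsum, hsum]
  exact Finset.sum_congr rfl fun i _ => by rw [card_filter_rk_eq hM hNM hB hB']

instance finite_dual : Finite (Dual F M) := Module.finite_of_finite F

/-- The pairs `(φ, u)` of nonzero vectors such that the map `x ↦ φ x • u` belongs to `B`. -/
def rankOnePairs (B : Submodule F (M →ₗ[F] N)) : Set (Dual F M × N) :=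
  {p | p.1 ≠ 0 ∧ p.2 ≠ 0 ∧ p.1.smulRight p.2 ∈ B}

instance finite_of_finiteDimensional_target : Finite (Dual F M × N) :=
  have : Finite N := Module.finite_of_finite F
  inferInstance

theorem ncard_rankOnePairs_eq_sum (B : Submodule F (M →ₗ[F] N)) :
    (rankOnePairs B).ncard =
      ∑ A ∈ elems B, {p : Dual F M × N | p.1 ≠ 0 ∧ p.2 ≠ 0 ∧ p.1.smulRight p.2 = A}.ncard := by
  classical
  rw [Set.ncard_eq_toFinset_card (rankOnePairs B),
    Finset.card_eq_sum_card_fiberwise (t := elems B) (f := fun p => p.1.smulRight p.2)]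
  · refine Finset.sum_congr rfl fun A hA => ?_
    rw [Set.ncard_eq_toFinset_card]
    congr 1
    ext p
    simp only [Finset.mem_filter, Set.Finite.mem_toFinset, rankOnePairs, Set.mem_ofPred_eq]
    constructor
    · exact fun h => ⟨h.1.1, h.1.2.1, h.2⟩
    · exact fun h => ⟨⟨h.1, h.2.1, h.2.2 ▸ mem_elems.1 hA⟩, h.2.2⟩
  · intro p hp
    rw [Finset.mem_coe, Set.Finite.mem_toFinset] at hp
    exact mem_elems.2 hp.2.2

theorem ncard_smulRight_eq_of_rk_eq {A B : M →ₗ[F] N} (h : rk A = rk B) :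
    {p : Dual F M × N | p.1 ≠ 0 ∧ p.2 ≠ 0 ∧ p.1.smulRight p.2 = A}.ncard =
      {p : Dual F M × N | p.1 ≠ 0 ∧ p.2 ≠ 0 ∧ p.1.smulRight p.2 = B}.ncard := by
  suffices H : ∀ {A B : M →ₗ[F] N}, rk A = rk B →
      {p : Dual F M × N | p.1 ≠ 0 ∧ p.2 ≠ 0 ∧ p.1.smulRight p.2 = A}.ncard ≤
        {p : Dual F M × N | p.1 ≠ 0 ∧ p.2 ≠ 0 ∧ p.1.smulRight p.2 = B}.ncard from
    le_antisymm (H h) (H h.symm)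
  intro A B h
  obtain ⟨e, f, rfl⟩ := exists_arrowCongr_eq_of_rk_eq h
  refine Set.ncard_le_ncard_of_injOn (fun p => (p.1 ∘ₗ e.symm.toLinearMap, f p.2)) ?_ ?_
    (Set.toFinite _)
  · rintro ⟨φ, u⟩ ⟨hφ, hu, hA⟩
    refine ⟨fun h => hφ ?_, by simpa using hu, ?_⟩
    · ext x
      simpa using LinearMap.congr_fun h (e x)
    · ext x
      rw [← hA]
      simp [LinearEquiv.arrowCongr_apply]
  · rintro ⟨φ, u⟩ _ ⟨φ', u'⟩ _ h
    simp only [Prod.mk.injEq] at h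
    refine Prod.ext ?_ (f.injective h.2)
    ext x
    simpa using LinearMap.congr_fun h.1 (e x)

theorem smulRight_mem_homInto_iff {U : Submodule F N} {φ : Dual F M} (hφ : φ ≠ 0) {u : N} :
    φ.smulRight u ∈ homInto M U ↔ u ∈ U := by
  refine ⟨fun h => ?_, fun h x => U.smul_mem _ h⟩
  obtain ⟨x, hx⟩ : ∃ x, φ x ≠ 0 := by
    by_contra! h
    exact hφ (LinearMap.ext h)
  exact (U.smul_mem_iff hx).1 (h x)

theorem ncard_ne_zero_mem (U : Submodule F N) :
    {u : N | u ≠ 0 ∧ u ∈ U}.ncard = Nat.card F ^ finrank F U - 1 := by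
  have : Finite N := Module.finite_of_finite F
  have h : {u : N | u ≠ 0 ∧ u ∈ U} = (U : Set N) \ {0} := by
    ext u
    simp [and_comm]
  rw [h, Set.ncard_sdiff_singleton_of_mem U.zero_mem, ← Module.natCard_eq_pow_finrank]
  rfl

theorem ncard_rankOnePairs_homInto (U : Submodule F N) :
    (rankOnePairs (homInto M U)).ncard =
      (Nat.card F ^ finrank F M - 1) * (Nat.card F ^ finrank F U - 1) := by
  have h : rankOnePairs (homInto M U) =
      {φ : Dual F M | φ ≠ 0 ∧ φ ∈ (⊤ : Submodule F (Dual F M))} ×ˢ {u : N | u ≠ 0 ∧ u ∈ U} := by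
    ext ⟨φ, u⟩
    simp only [rankOnePairs, Set.mem_ofPred_eq, Set.mem_prod, mem_top, and_true]
    constructor
    · exact fun h => ⟨h.1, h.2.1, (smulRight_mem_homInto_iff h.1).1 h.2.2⟩
    · exact fun h => ⟨h.1, h.2.1, (smulRight_mem_homInto_iff h.1).2 h.2.2⟩
  rw [h, Set.ncard_prod, ncard_ne_zero_mem, ncard_ne_zero_mem, finrank_top,
    Subspace.dual_finrank_eq]

/-- The number of pairs representing a map depends only on its rank, so equality of rank
distributions reduces the count to Hom(M, U). -/
theorem IsOptimal.ncard_rankOnePairs (hM : 0 < finrank F M) (hNM : finrank F N ≤ finrank F M)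
    {B : Submodule F (M →ₗ[F] N)} {v : ℕ} (hB : IsOptimal B v) :
    (rankOnePairs B).ncard = (Nat.card F ^ finrank F M - 1) * (Nat.card F ^ v - 1) := by
  obtain ⟨U, hU, hopt⟩ := exists_isOptimal (M := M) hB.le
  rw [ncard_rankOnePairs_eq_sum,
    sum_elems_eq_of_isOptimal hM hNM hB hopt (fun h => ncard_smulRight_eq_of_rk_eq h),
    ← ncard_rankOnePairs_eq_sum, ncard_rankOnePairs_homInto, hU]

/-- An optimal space attains its maximal rank. -/
theorem IsOptimal.exists_rk_eq (hM : 0 < finrank F M) (hNM : finrank F N ≤ finrank F M)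
    {B : Submodule F (M →ₗ[F] N)} {v : ℕ} (hB : IsOptimal B v) : ∃ A ∈ B, rk A = v := by
  obtain ⟨D, hD⟩ := exists_isMRDChain F M N hM hNM
  rcases Nat.eq_zero_or_pos v with rfl | hv
  · exact ⟨0, B.zero_mem, rk_eq_zero_iff.2 rfl⟩
  by_contra! h
  have h1 := hD.finrank_le (B := B) (v := v - 1)
    (fun A hA => by
      have := hB.rk_le A hA
      have := h A hA
      omega) (by have := hB.le; omega)
  rw [hB.finrank_eq] at h1
  have := Nat.le_of_mul_le_mul_left h1 hM
  omega

end RankDistribution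

/-! ### Classification of optimal spaces by counting rank-one maps. -/

section Classification

variable {F : Type*} [Field F] {M N : Type*} [AddCommGroup M] [Module F M]
  [AddCommGroup N] [Module F N] [FiniteDimensional F M] [FiniteDimensional F N]

theorem rk_lt_rk_add_smulRight {A : M →ₗ[F] N} {φ : Dual F M} {u : N}
    (hu : u ∉ LinearMap.range A) {k : M} (hk : A k = 0) (hφ : φ k ≠ 0) :
    rk A < rk (A + φ.smulRight u) := by
  refine Submodule.finrank_lt_finrank_of_lt (SetLike.lt_iff_le_and_exists.2 ⟨?_, u, ?_, hu⟩)
  · rintro _ ⟨w, rfl⟩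
    refine ⟨w - (φ w / φ k) • k, ?_⟩
    simp [hk, hφ]
  · refine ⟨(φ k)⁻¹ • k, ?_⟩
    simp [hk, hφ]

theorem ncard_le_mul_of_fiber_le {α β : Type*} [Finite α] [Finite β] {S : Set (α × β)} {T : Set β}
    {c : ℕ} (hT : ∀ p ∈ S, p.2 ∈ T) (hc : ∀ b ∈ T, {a | (a, b) ∈ S}.ncard ≤ c) :
    S.ncard ≤ T.ncard * c := by
  classical
  let _ := Fintype.ofFinite α
  let _ := Fintype.ofFinite β
  rw [Set.ncard_eq_toFinset_card S, Set.ncard_eq_toFinset_card T, mul_comm]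
  refine Finset.card_le_mul_card_image_of_maps_to (f := Prod.snd) ?_ c ?_
  · intro p hp
    rw [Set.Finite.mem_toFinset] at hp ⊢
    exact hT p hp
  · intro b hb
    rw [Set.Finite.mem_toFinset] at hb
    refine le_trans ?_ (hc b hb)
    rw [Set.ncard_eq_toFinset_card]
    refine Finset.card_le_card_of_injOn Prod.fst ?_ ?_
    · rintro ⟨a, b'⟩ h
      simp only [Finset.coe_filter, Set.Finite.mem_toFinset, Set.mem_ofPred_eq] at h
      obtain ⟨h, rfl⟩ := h
      simpa using h
    · rintro ⟨a, b'⟩ h ⟨a', b''⟩ h' heq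
      simp only [Finset.coe_filter, Set.Finite.mem_toFinset, Set.mem_ofPred_eq] at h h' heq
      rw [h.2, h'.2, heq]

/-- The left side grows with N; at N = qb the right side exceeds it by q(q - 2)ab + qa(a - 1) + b.
It is used with a = q^(v-1), b = q^(dim M - 1) and N = q^(dim N). -/
theorem mul_add_mul_lt_mul {q a b N : ℕ} (hq : 2 ≤ q) (ha : 1 ≤ a) (hb : 1 ≤ b)
    (haN : q * a ≤ N) (hN : N ≤ q * b) :
    (N - q * a) * (a - 1) + (q * a - 1) * (b - 1) < (q * b - 1) * (q * a - 1) := by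
  have h1 : 1 ≤ q * a := Nat.mul_pos (by omega) ha
  have h2 : 1 ≤ q * b := Nat.mul_pos (by omega) hb
  refine lt_of_le_of_lt (b := (q * b - q * a) * (a - 1) + (q * a - 1) * (b - 1)) (by gcongr) ?_
  obtain ⟨q, rfl⟩ := Nat.exists_eq_add_of_le hq
  zify [h1, h2, ha, hb, haN.trans hN]
  have h3 : (0 : ℤ) ≤ (2 + q) * a * b * q := by positivity
  have h4 : (0 : ℤ) ≤ (2 + q) * a * (a - 1) := by
    have : (0 : ℤ) ≤ a - 1 := by omega
    positivity
  have h5 : (1 : ℤ) ≤ b := by omega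
  nlinarith

variable [Finite F]

/-- A rank-one map φ ⊗ u in B with u outside the range of A must have φ zero on ker A, since
otherwise A + φ ⊗ u has rank above v. If some ψ ⊗ x in B violates the conclusion, then x = A z, and
A + ψ ⊗ x imposes on φ the further condition φ z = 0. So at most q^(v-1) - 1 functionals remain for
each u outside the range, and at most q^(dim M - 1) - 1 for each nonzero u inside, where fullness
fails. The total falls short of the known number of pairs. -/
theorem IsOptimal.ker_le_ker (hM : 0 < finrank F M) (hNM : finrank F N ≤ finrank F M)
    {B : Submodule F (M →ₗ[F] N)} {v : ℕ} (hB : IsOptimal B v)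
    (hfull : ∀ u ≠ 0, ∃ φ : Dual F M, φ.smulRight u ∉ B)
    {A : M →ₗ[F] N} (hA : A ∈ B) (hAv : rk A = v) {ψ : Dual F M} {x : N} (hx : x ≠ 0)
    (hψx : ψ.smulRight x ∈ B) : LinearMap.ker A ≤ LinearMap.ker ψ := by
  intro k hk
  by_contra hψk
  rw [LinearMap.mem_ker] at hk hψk
  have hmem : ∀ {A' : M →ₗ[F] N} {φ : Dual F M} {u : N}, A' ∈ B → v ≤ rk A' →
      φ.smulRight u ∈ B → u ∉ LinearMap.range A' → ∀ y, A' y = 0 → φ y = 0 := by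
    intro A' φ u hA' hv hφu hu y hy
    by_contra hφ
    have h1 := rk_lt_rk_add_smulRight hu hy hφ
    have h2 := hB.rk_le _ (B.add_mem hA' hφu)
    omega
  obtain ⟨z, hz⟩ : x ∈ LinearMap.range A := by
    by_contra h
    exact hψk (hmem hA hAv.ge hψx h k hk)
  let K := LinearMap.ker A ⊔ F ∙ z
  have hann : ∀ u ∉ LinearMap.range A, ∀ φ : Dual F M, φ.smulRight u ∈ B →
      φ ∈ K.dualAnnihilator := by
    intro u hu φ hφ
    have h1 := hmem hA hAv.ge hφ hu
    have h2 : v ≤ rk (A + ψ.smulRight x) := by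
      rw [← hAv]
      refine Submodule.finrank_mono ?_
      rintro _ ⟨w, rfl⟩
      refine ⟨w - (ψ w / ψ k) • k, ?_⟩
      simp [hk, hψk]
    have h3 : u ∉ LinearMap.range (A + ψ.smulRight x) := by
      rintro ⟨w, rfl⟩
      refine hu ⟨w + ψ w • z, ?_⟩
      simp [hz]
    -- On this vector A takes the value x and ψ the value -1, so A + ψ ⊗ x vanishes there.
    have h4 := hmem (B.add_mem hA hψx) h2 hφ h3 (z + ((-1 - ψ z) / ψ k) • k) (by
      simp [hk, hψk, hz])
    rw [map_add, map_smul, h1 k hk, smul_zero, add_zero] at h4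
    rw [mem_dualAnnihilator]
    intro y hy
    obtain ⟨y₁, hy₁, y₂, hy₂, rfl⟩ := Submodule.mem_sup.1 hy
    obtain ⟨c, rfl⟩ := Submodule.mem_span_singleton.1 hy₂
    rw [map_add, map_smul, h1 y₁ hy₁, h4, smul_zero, add_zero]
  have hKdim : finrank F K.dualAnnihilator = v - 1 := by
    have hzA : z ∉ LinearMap.ker A := by
      rw [LinearMap.mem_ker, hz]
      exact hx
    have hz0 : z ≠ 0 := by
      rintro rfl
      exact hzA (Submodule.zero_mem _)
    have h1 := Submodule.finrank_sup_add_finrank_inf_eq (LinearMap.ker A) (F ∙ z)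
    have h2 : LinearMap.ker A ⊓ F ∙ z = ⊥ := by
      rw [← disjoint_iff, Submodule.disjoint_span_singleton' hz0]
      exact hzA
    rw [h2, finrank_bot, finrank_span_singleton hz0] at h1
    have h3 := LinearMap.finrank_range_add_finrank_ker A
    have h4 := Subspace.finrank_add_finrank_dualAnnihilator_eq K
    have h5 : finrank F K = finrank F (LinearMap.ker A) + 1 := h1
    have h6 : finrank F (LinearMap.range A) = v := hAv
    omega
  have hv1 : 1 ≤ v := by
    rw [← hAv]
    refine Nat.pos_of_ne_zero fun h => hx ?_
    rw [← hz, rk_eq_zero_iff.1 h, LinearMap.zero_apply]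
  have : Finite N := Module.finite_of_finite F
  let S := rankOnePairs B
  let S₁ : Set (Dual F M × N) := {p ∈ S | p.2 ∉ LinearMap.range A}
  let S₂ : Set (Dual F M × N) := {p ∈ S | p.2 ∈ LinearMap.range A}
  have hS : S ⊆ S₁ ∪ S₂ := by
    intro p hp
    by_cases h : p.2 ∈ LinearMap.range A
    · exact Or.inr ⟨hp, h⟩
    · exact Or.inl ⟨hp, h⟩
  have hq : 2 ≤ Nat.card F := Finite.one_lt_card
  have hS₁ : S₁.ncard ≤ (Nat.card F ^ finrank F N - Nat.card F ^ v) *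
      (Nat.card F ^ (v - 1) - 1) := by
    have hT : ((LinearMap.range A : Set N)ᶜ).ncard =
        Nat.card F ^ finrank F N - Nat.card F ^ v := by
      rw [Set.ncard_compl, ← hAv, ← Module.natCard_eq_pow_finrank, ← Module.natCard_eq_pow_finrank]
      rfl
    rw [← hT]
    refine ncard_le_mul_of_fiber_le (fun p hp => hp.2) fun u hu => ?_
    rw [← hKdim, ← ncard_ne_zero_mem]
    exact Set.ncard_le_ncard (fun φ hφ => ⟨hφ.1.1, hann u hu φ hφ.1.2.2⟩) (Set.toFinite _)
  have hS₂ : S₂.ncard ≤ (Nat.card F ^ v - 1) * (Nat.card F ^ (finrank F M - 1) - 1) := by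
    have hT := ncard_ne_zero_mem (LinearMap.range A)
    rw [show finrank F (LinearMap.range A) = v from hAv] at hT
    rw [← hT]
    refine ncard_le_mul_of_fiber_le (fun p hp => ⟨hp.1.2.1, hp.2⟩) fun u hu => ?_
    obtain ⟨φ₀, hφ₀⟩ := hfull u hu.1
    let P : Submodule F (Dual F M) := B.comap (LinearMap.smulRightₗ.flip u)
    have hP : finrank F P < finrank F M := by
      rw [← Subspace.dual_finrank_eq (K := F) (V := M)]
      exact Submodule.finrank_lt (fun h => hφ₀ (h ▸ Submodule.mem_top : φ₀ ∈ P))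
    calc _ ≤ {φ : Dual F M | φ ≠ 0 ∧ φ ∈ P}.ncard :=
          Set.ncard_le_ncard (fun φ hφ => ⟨hφ.1.1, hφ.1.2.2⟩) (Set.toFinite _)
      _ = Nat.card F ^ finrank F P - 1 := ncard_ne_zero_mem P
      _ ≤ _ := Nat.sub_le_sub_right (Nat.pow_le_pow_right (by omega) (by omega)) 1
  have h1 := (Set.ncard_le_ncard hS (Set.toFinite _)).trans (Set.ncard_union_le S₁ S₂)
  have h2 : S.ncard = _ := hB.ncard_rankOnePairs hM hNM
  obtain ⟨w, rfl⟩ := Nat.exists_eq_add_of_le' hv1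
  obtain ⟨l, hl⟩ := Nat.exists_eq_add_of_le' hM
  have h3 := mul_add_mul_lt_mul (N := Nat.card F ^ finrank F N) hq
    (Nat.one_le_pow w (Nat.card F) (by omega)) (Nat.one_le_pow l (Nat.card F) (by omega))
    (by rw [← pow_succ']; exact Nat.pow_le_pow_right (by omega) hB.le)
    (by rw [← pow_succ']; exact Nat.pow_le_pow_right (by omega) (by omega))
  rw [hl] at h2 hS₂
  simp only [Nat.add_sub_cancel, pow_succ'] at h2 hS₁ hS₂
  omega

theorem exists_notMem_range_of_dual {A : M →ₗ[F] N} {u : N} (hu : u ∉ LinearMap.range A) :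
    ∃ g : Dual F N, g ∘ₗ A = 0 ∧ g u ≠ 0 := by
  obtain ⟨g, hg, hgA⟩ := Submodule.exists_dual_map_eq_bot_of_notMem hu inferInstance
  refine ⟨g, ?_, hg⟩
  ext x
  have : g (A x) ∈ (LinearMap.range A).map g :=
    Submodule.mem_map_of_mem (LinearMap.mem_range_self A x)
  rwa [hgA, Submodule.mem_bot] at this

/-- If both alternatives fail, `ker_le_ker` confines every φ to the v-dimensional annihilator of ker
A, while the vectors u lie in a space of dimension less than dim M. There are then fewer than
(q^(dim M) - 1)(q^v - 1) pairs. -/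
theorem IsOptimal.exists_smulRight_mem (hNM : finrank F N ≤ finrank F M)
    {B : Submodule F (M →ₗ[F] N)} {v : ℕ} (hv : 1 ≤ v) (hB : IsOptimal B v) :
    (∃ u ≠ 0, ∀ φ : Dual F M, φ.smulRight u ∈ B) ∨
      (finrank F N = finrank F M ∧ ∃ φ : Dual F M, φ ≠ 0 ∧ ∀ u, φ.smulRight u ∈ B) := by
  have hvN := hB.le
  have hM : 0 < finrank F M := by omega
  have : Finite N := Module.finite_of_finite F
  by_contra! h
  obtain ⟨hu, hφ⟩ := h
  by_cases hvM : v = finrank F M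
  · have hBtop : B = ⊤ := by
      apply Submodule.eq_top_of_finrank_eq
      rw [hB.finrank_eq, Module.finrank_linearMap]
      congr 1
      omega
    have : Nontrivial N := Module.nontrivial_of_finrank_pos (R := F) (by omega)
    obtain ⟨u, hu0⟩ := exists_ne (0 : N)
    obtain ⟨φ, h⟩ := hu u hu0
    exact h (hBtop ▸ Submodule.mem_top)
  obtain ⟨A, hA, hAv⟩ := hB.exists_rk_eq hM hNM
  have hann : finrank F (LinearMap.ker A).dualAnnihilator = v := by
    have h3 := LinearMap.finrank_range_add_finrank_ker A
    have h4 := Subspace.finrank_add_finrank_dualAnnihilator_eq (LinearMap.ker A)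
    have h6 : finrank F (LinearMap.range A) = v := hAv
    omega
  obtain ⟨U, hU, hUM⟩ : ∃ U : Submodule F N,
      (∀ p ∈ rankOnePairs B, p.2 ∈ U) ∧ finrank F U < finrank F M := by
    by_cases hlt : finrank F N < finrank F M
    · exact ⟨⊤, fun _ _ => Submodule.mem_top, by rwa [finrank_top]⟩
    have heq : finrank F N = finrank F M := by omega
    -- In the square case `ker_le_ker` applied to the transposed space puts u into the range of A: a
    -- functional that kills the range but not u would lie in the kernel of the transpose of A and
    -- not in that of evaluation at u.
    refine ⟨LinearMap.range A, ?_, by rw [show finrank F (LinearMap.range A) = v from hAv]; omega⟩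
    rintro ⟨φ, u⟩ ⟨hφ0, hu0, hφu⟩
    by_contra hun
    obtain ⟨g, hgA, hgu⟩ := exists_notMem_range_of_dual hun
    obtain ⟨e⟩ : Nonempty (Dual F M ≃ₗ[F] M) :=
      ⟨LinearEquiv.ofFinrankEq _ _ Subspace.dual_finrank_eq⟩
    obtain ⟨f⟩ : Nonempty (Dual F N ≃ₗ[F] N) :=
      ⟨LinearEquiv.ofFinrankEq _ _ Subspace.dual_finrank_eq⟩
    let T := transposeEquiv e f
    let ev : N → Dual F N := fun u => (LinearMap.flip LinearMap.id u) ∘ₗ f.symm.toLinearMap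
    have hT : ∀ (φ : Dual F M) (u : N), T (φ.smulRight u) = (ev u).smulRight (e φ) := by
      intro φ u
      ext y
      change e (f.symm y ∘ₗ φ.smulRight u) = f.symm y u • e φ
      rw [← map_smul]
      congr 1
      ext x
      simp [mul_comm]
    have hopt : IsOptimal (B.map T.toLinearMap) v := by
      refine ⟨?_, hvN.trans hNM, ?_⟩
      · rintro _ ⟨A, hA, rfl⟩
        exact (rk_transposeEquiv e f A).trans_le (hB.rk_le A hA)
      · rw [heq, ← hB.finrank_eq]
        exact LinearEquiv.finrank_map_eq T B
    have hker := hopt.ker_le_ker (by omega) heq.ge (A := T A) (ψ := ev u) (x := e φ) ?_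
      ⟨A, hA, rfl⟩ ((rk_transposeEquiv e f A).trans hAv) (by simpa using hφ0)
      ⟨_, hφu, hT φ u⟩
    · have h1 : f g ∈ LinearMap.ker (T A) := by
        rw [LinearMap.mem_ker]
        change e (f.symm (f g) ∘ₗ A) = 0
        rw [f.symm_apply_apply, hgA, map_zero]
      have h2 : f.symm (f g) u = 0 := hker h1
      rw [f.symm_apply_apply] at h2
      exact hgu h2
    · intro w hw
      obtain ⟨u', hu'⟩ := hφ heq (e.symm w) (by simpa using hw)
      refine ⟨ev u', ?_⟩
      rintro ⟨A', hA', h⟩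
      apply hu'
      have : A' = (e.symm w).smulRight u' := by
        apply T.injective
        rw [hT, e.apply_symm_apply]
        exact h
      exact this ▸ hA'
  have hcount : (rankOnePairs B).ncard ≤
      (Nat.card F ^ finrank F U - 1) * (Nat.card F ^ v - 1) := by
    rw [← ncard_ne_zero_mem U]
    refine ncard_le_mul_of_fiber_le (fun p hp => ⟨hp.2.1, hU p hp⟩) fun u hu0 => ?_
    rw [← hann, ← ncard_ne_zero_mem]
    refine Set.ncard_le_ncard (fun φ hφ => ⟨hφ.1, ?_⟩) (Set.toFinite _)
    rw [mem_dualAnnihilator]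
    exact fun k hk => hB.ker_le_ker hM hNM hu hA hAv hu0.1 hφ.2.2 hk
  rw [hB.ncard_rankOnePairs hM hNM] at hcount
  have hq : 1 < Nat.card F := Finite.one_lt_card
  have h1 : 1 < Nat.card F ^ v := Nat.one_lt_pow (by omega) hq
  have h2 := Nat.pow_lt_pow_right hq hUM
  have h3 := Nat.one_le_pow (finrank F U) (Nat.card F) (by omega)
  have h4 := Nat.le_of_mul_le_mul_right hcount (by omega)
  omega

/-- The vectors `u` such that `B` contains all maps with range in the line of `u`. -/
def fullVectors (B : Submodule F (M →ₗ[F] N)) : Submodule F N where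
  carrier := {u | ∀ φ : Dual F M, φ.smulRight u ∈ B}
  zero_mem' φ := by simp
  add_mem' {u u'} hu hu' φ := by
    have : φ.smulRight (u + u') = φ.smulRight u + φ.smulRight u' := by
      ext
      simp
    exact this ▸ B.add_mem (hu φ) (hu' φ)
  smul_mem' c u hu φ := by
    have : φ.smulRight (c • u) = c • φ.smulRight u :=
      LinearMap.ext fun x => smul_comm (φ x) c u
    exact this ▸ B.smul_mem c (hu φ)

theorem homInto_fullVectors_le (B : Submodule F (M →ₗ[F] N)) :
    homInto M (fullVectors B) ≤ B := by
  intro A hA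
  let b := Module.finBasis F M
  have : A = ∑ i, (b.coord i).smulRight (A (b i)) := by
    refine b.ext fun j => ?_
    simp [LinearMap.sum_apply, Finsupp.single_apply]
  rw [this]
  exact B.sum_mem fun i _ => hA (b i) _

theorem rk_mkQ_comp_add_finrank {C : M →ₗ[F] N} {V : Submodule F N}
    (hV : V ≤ LinearMap.range C) : rk (V.mkQ ∘ₗ C) + finrank F V = rk C := by
  have h1 := LinearMap.finrank_range_add_finrank_ker (V.mkQ.domRestrict (LinearMap.range C))
  have h2 : LinearMap.range (V.mkQ.domRestrict (LinearMap.range C)) =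
      LinearMap.range (V.mkQ ∘ₗ C) := by
    rw [LinearMap.range_domRestrict, LinearMap.range_comp]
  have h3 : LinearMap.ker (V.mkQ.domRestrict (LinearMap.range C)) =
      V.comap (LinearMap.range C).subtype := by
    rw [LinearMap.ker_domRestrict, Submodule.ker_mkQ]
  rw [h2, h3, LinearEquiv.finrank_eq (Submodule.comapSubtypeEquivOfLe hV)] at h1
  exact h1

/-- Since dim N ≤ dim M, the kernel of M → N/V has dimension at least dim V. On it A already takes
values in V, so a correction with values in V can make the sum map a part of it onto V. -/
theorem exists_add_range_ge (hNM : finrank F N ≤ finrank F M) (A : M →ₗ[F] N)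
    (V : Submodule F N) : ∃ X ∈ homInto M V, V ≤ LinearMap.range (A + X) := by
  let K := LinearMap.ker (V.mkQ ∘ₗ A)
  have hAK : ∀ k ∈ K, A k ∈ V := fun k hk => by simpa [K] using hk
  have hdim : finrank F V ≤ finrank F K := by
    have h1 := LinearMap.finrank_range_add_finrank_ker (V.mkQ ∘ₗ A)
    have h2 := Submodule.finrank_le (LinearMap.range (V.mkQ ∘ₗ A))
    have h3 := Submodule.finrank_quotient_add_finrank V
    have h4 : finrank F K = finrank F (LinearMap.ker (V.mkQ ∘ₗ A)) := rfl
    omega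
  obtain ⟨ι, hι⟩ := exists_injective_of_finrank_le hdim
  obtain ⟨s, hs⟩ := ι.exists_leftInverse_of_injective (LinearMap.ker_eq_bot.2 hι)
  obtain ⟨r, hr⟩ := K.subtype.exists_leftInverse_of_injective K.ker_subtype
  obtain ⟨p, hp⟩ := V.subtype.exists_leftInverse_of_injective V.ker_subtype
  refine ⟨V.subtype ∘ₗ (s ∘ₗ r - p ∘ₗ A), fun x => (s (r x) - p (A x)).2, fun y hy => ?_⟩
  let k : K := ι ⟨y, hy⟩
  have h1 : r k = k := LinearMap.congr_fun hr k
  have h2 : s k = ⟨y, hy⟩ := LinearMap.congr_fun hs ⟨y, hy⟩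
  have h3 : p (A k) = ⟨A k, hAK k k.2⟩ := LinearMap.congr_fun hp ⟨A k, hAK k k.2⟩
  exact ⟨k, by simp [h1, h2, h3]⟩

/-- If V, the space of full vectors, had dimension below v, the image of B in Hom(M, N/V) would be
optimal and contain a new full vector; its lifts to N are full for B, hence lie in V, a
contradiction. -/
theorem IsOptimal.eq_homInto_fullVectors (hNM : finrank F N ≤ finrank F M)
    {B : Submodule F (M →ₗ[F] N)} {v : ℕ} (hB : IsOptimal B v)
    (hfull : ∃ u ≠ 0, ∀ φ : Dual F M, φ.smulRight u ∈ B) :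
    finrank F (fullVectors B) = v ∧ B = homInto M (fullVectors B) := by
  obtain ⟨u, hu0, hu⟩ := hfull
  set V := fullVectors B with hV
  have hle : homInto M V ≤ B := homInto_fullVectors_le B
  have hV1 : 1 ≤ finrank F V := by
    refine Nat.pos_of_ne_zero fun h => hu0 ?_
    have : u ∈ V := hu
    rwa [Submodule.finrank_eq_zero.1 h, Submodule.mem_bot] at this
  have hVN := Submodule.finrank_le V
  have hM : 0 < finrank F M := by omega
  have hVv : finrank F V ≤ v := by
    have := Submodule.finrank_mono hle
    rw [finrank_homInto, hB.finrank_eq] at this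
    exact Nat.le_of_mul_le_mul_left this hM
  have key : ¬ finrank F V < v := by
    intro hlt
    have hquot := Submodule.finrank_quotient_add_finrank V
    let π : (M →ₗ[F] N) →ₗ[F] (M →ₗ[F] N ⧸ V) := LinearMap.compRight F V.mkQ
    have hπ : ∀ A, π A = V.mkQ ∘ₗ A := fun _ => rfl
    have hker : ∀ A, π A = 0 ↔ A ∈ homInto M V := by
      intro A
      rw [LinearMap.ext_iff, mem_homInto]
      simp [hπ]
    have hopt : IsOptimal (B.map π) (v - finrank F V) := by
      have hvN := hB.le
      refine ⟨?_, by omega, ?_⟩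
      · rintro _ ⟨A, hA, rfl⟩
        -- A representative whose range contains V loses exactly dim V in rank when passing to N/V.
        obtain ⟨X, hX, hr⟩ := exists_add_range_ge hNM A V
        have h1 := rk_mkQ_comp_add_finrank hr
        have h2 := hB.rk_le _ (B.add_mem hA (hle hX))
        have h3 : π A = V.mkQ ∘ₗ (A + X) := by
          rw [← hπ, map_add, (hker X).2 hX, add_zero]
        rw [h3]
        omega
      · have h1 := LinearMap.finrank_range_add_finrank_ker (π.domRestrict B)
        have h3 : LinearMap.ker (π.domRestrict B) = (homInto M V).comap B.subtype := by
          ext A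
          exact hker A
        rw [LinearMap.range_domRestrict, h3,
          LinearEquiv.finrank_eq (Submodule.comapSubtypeEquivOfLe hle), finrank_homInto,
          hB.finrank_eq] at h1
        rw [Nat.mul_sub]
        omega
    -- As V is nonzero, dim N/V < dim M, so the square alternative cannot occur.
    rcases hopt.exists_smulRight_mem (by omega) (by omega) with ⟨u', hu'0, hu'⟩ | h
    · obtain ⟨w, rfl⟩ := V.mkQ_surjective u'
      refine hu'0 ?_
      rw [Submodule.mkQ_apply, Submodule.Quotient.mk_eq_zero]
      intro φ
      obtain ⟨A, hA, hAφ⟩ := hu' φ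
      have h1 : π (φ.smulRight w) = φ.smulRight (V.mkQ w) := by
        ext x
        simp [hπ]
      have h2 : φ.smulRight w - A ∈ homInto M V := by
        rw [← hker, map_sub, h1, hAφ, sub_self]
      simpa using B.add_mem (hle h2) hA
    · omega
  have hVeq : finrank F V = v := by omega
  refine ⟨hVeq, (Submodule.eq_of_le_of_finrank_eq hle ?_).symm⟩
  rw [finrank_homInto, hB.finrank_eq, hVeq]

end Classification

/-! ### Trace duality and transposition of codes. -/

section Duality

variable {F : Type*} [Field F] {n m : ℕ}

theorem trace_mul_transpose_comm (A B : Matrix (Fin n) (Fin m) F) :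
    Matrix.trace (B * A.transpose) = Matrix.trace (A * B.transpose) := by
  rw [← Matrix.trace_transpose, Matrix.transpose_mul, Matrix.transpose_transpose]

/-- The trace form on the space of matrices. -/
noncomputable def traceForm (F : Type*) [Field F] (n m : ℕ) :
    LinearMap.BilinForm F (Matrix (Fin n) (Fin m) F) :=
  LinearMap.mk₂ F (fun A B => Matrix.trace (B * A.transpose))
    (fun A A' B => by simp [Matrix.mul_add]) (fun c A B => by simp)
    (fun A B B' => by simp [Matrix.add_mul]) (fun c A B => by simp)

theorem traceForm_apply (A B : Matrix (Fin n) (Fin m) F) :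
    traceForm F n m A B = Matrix.trace (B * A.transpose) := rfl

theorem traceForm_isRefl : (traceForm F n m).IsRefl := by
  intro A B h
  rw [traceForm_apply] at h ⊢
  rwa [trace_mul_transpose_comm]

theorem trace_mul_transpose_vecMulVec (N : Matrix (Fin n) (Fin m) F) (x : Fin n → F)
    (w : Fin m → F) :
    Matrix.trace (N * (Matrix.vecMulVec x w).transpose) = Matrix.vecMul x N ⬝ᵥ w := by
  rw [Matrix.transpose_vecMulVec, Matrix.mul_vecMulVec, Matrix.trace_vecMulVec,
    ← Matrix.dotProduct_mulVec, dotProduct_comm]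

theorem traceForm_nondegenerate : (traceForm F n m).Nondegenerate := by
  have hr : (traceForm F n m).SeparatingRight := by
    intro A h
    ext i j
    have := h (Matrix.vecMulVec (Pi.single i 1) (Pi.single j 1))
    rw [traceForm_apply, trace_mul_transpose_vecMulVec] at this
    simpa using this
  exact ⟨fun A h => hr A fun B => traceForm_isRefl A B (h B), hr⟩

theorem dual_eq_orthogonal (C : Code F n m) : dual C = (traceForm F n m).orthogonal C := by
  ext B
  rfl

theorem finrank_add_finrank_dual (C : Code F n m) :
    finrank F C + finrank F (dual C) = n * m := by
  have h := Submodule.finrank_le C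
  rw [dual_eq_orthogonal, LinearMap.BilinForm.finrank_orthogonal traceForm_nondegenerate,
    Nat.add_sub_cancel' h, Module.finrank_matrix]
  simp

theorem dual_dual (C : Code F n m) : dual (dual C) = C := by
  rw [dual_eq_orthogonal, dual_eq_orthogonal,
    LinearMap.BilinForm.orthogonal_orthogonal traceForm_nondegenerate traceForm_isRefl]

theorem dual_antitone {C D : Code F n m} (h : C ≤ D) : dual D ≤ dual C :=
  fun _ hB A hA => hB A (h hA)

theorem dual_sup (C D : Code F n m) : dual (C ⊔ D) = dual C ⊓ dual D := by
  refine le_antisymm (le_inf (dual_antitone le_sup_left) (dual_antitone le_sup_right)) ?_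
  rintro B ⟨hC, hD⟩ A hA
  obtain ⟨A₁, h₁, A₂, h₂, rfl⟩ := Submodule.mem_sup.1 hA
  rw [Matrix.transpose_add, Matrix.mul_add, Matrix.trace_add, hC _ h₁, hD _ h₂, add_zero]

theorem finrank_dual_inf_dual (C D : Code F n m) :
    finrank F (dual C ⊓ dual D : Code F n m) + finrank F C + finrank F D =
      n * m + finrank F (C ⊓ D : Code F n m) := by
  have h1 := finrank_add_finrank_dual (C ⊔ D)
  have h2 := Submodule.finrank_sup_add_finrank_inf_eq C D
  rw [dual_sup] at h1
  omega

/-- The code of the transposed matrices. -/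
def transposeCode (C : Code F n m) : Code F m n :=
  C.map (Matrix.transposeLinearEquiv (Fin n) (Fin m) F F).toLinearMap

theorem mem_transposeCode {C : Code F n m} {A : Matrix (Fin m) (Fin n) F} :
    A ∈ transposeCode C ↔ A.transpose ∈ C := by
  constructor
  · rintro ⟨A', hA', rfl⟩
    exact hA'
  · exact fun h => ⟨_, h, A.transpose_transpose⟩

theorem transposeCode_transposeCode (C : Code F n m) : transposeCode (transposeCode C) = C := by
  ext A
  rw [mem_transposeCode, mem_transposeCode, Matrix.transpose_transpose]

theorem transposeCode_mono {C D : Code F n m} (h : C ≤ D) : transposeCode C ≤ transposeCode D :=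
  Submodule.map_mono h

theorem finrank_transposeCode (C : Code F n m) : finrank F (transposeCode C) = finrank F C :=
  LinearEquiv.finrank_map_eq _ _

theorem dual_transposeCode (C : Code F n m) : dual (transposeCode C) = transposeCode (dual C) := by
  ext B
  rw [mem_transposeCode]
  constructor
  · intro h A hA
    have := h A.transpose (mem_transposeCode.2 hA)
    rw [← Matrix.trace_transpose, Matrix.transpose_mul, Matrix.trace_mul_comm] at this
    simpa using this
  · intro h A hA
    have := h A.transpose (mem_transposeCode.1 hA)
    rw [← Matrix.trace_transpose, Matrix.transpose_mul, Matrix.trace_mul_comm] at this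
    simpa using this

end Duality

/-! ### Optimal anticodes: extension, restriction and duality. -/

section Anticodes

variable {F : Type*} [Field F] {n m : ℕ}

theorem bddAbove_rank (A : Code F n m) : BddAbove {r : ℕ | ∃ M ∈ A, M.rank = r} :=
  ⟨n, by
    rintro _ ⟨M, -, rfl⟩
    exact M.rank_le_height⟩

theorem rank_le_maxrk {A : Code F n m} {M : Matrix (Fin n) (Fin m) F} (hM : M ∈ A) :
    M.rank ≤ maxrk A :=
  le_csSup (bddAbove_rank A) ⟨M, hM, rfl⟩

theorem exists_rank_eq_maxrk (A : Code F n m) : ∃ M ∈ A, M.rank = maxrk A :=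
  Nat.sSup_mem (s := {r : ℕ | ∃ M ∈ A, M.rank = r}) ⟨_, 0, A.zero_mem, rfl⟩ (bddAbove_rank A)

theorem maxrk_le (A : Code F n m) : maxrk A ≤ n := by
  obtain ⟨M, -, h⟩ := exists_rank_eq_maxrk A
  exact h ▸ M.rank_le_height

/-- Optimal anticodes of maximal rank `u`. -/
def IsAnticode (A : Code F n m) (u : ℕ) : Prop := IsOptimalAnticode A ∧ maxrk A = u

theorem IsAnticode.finrank_eq {A : Code F n m} {u : ℕ} (h : IsAnticode A u) :
    finrank F A = m * u := h.2 ▸ h.1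

theorem IsAnticode.le {A : Code F n m} {u : ℕ} (h : IsAnticode A u) : u ≤ n := h.2 ▸ maxrk_le A

/-- The space of linear maps given by the matrices of a code. -/
noncomputable def homs (A : Code F n m) : Submodule F ((Fin m → F) →ₗ[F] (Fin n → F)) :=
  A.map (Matrix.toLin' (R := F)).toLinearMap

theorem toLin'_mem_homs {A : Code F n m} {M : Matrix (Fin n) (Fin m) F} :
    M.toLin' ∈ homs A ↔ M ∈ A := by
  refine ⟨?_, fun h => ⟨M, h, rfl⟩⟩
  rintro ⟨M', hM', h⟩
  exact Matrix.toLin'.injective h ▸ hM'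

theorem finrank_homs (A : Code F n m) : finrank F (homs A) = finrank F A :=
  LinearEquiv.finrank_map_eq _ _

theorem IsAnticode.isOptimal {A : Code F n m} {u : ℕ} (h : IsAnticode A u) :
    IsOptimal (homs A) u := by
  refine ⟨?_, by simpa using h.le, by simpa [finrank_homs] using h.finrank_eq⟩
  rintro _ ⟨M, hM, rfl⟩
  exact h.2 ▸ rank_le_maxrk hM

variable [Finite F]

/-- An upper bound on the ranks suffices: if rank u > 0 were not attained, the dimension would be at
most m(u - 1). -/
theorem isAnticode_of_rank_le (hnm : n ≤ m) (hm : 0 < m) {A : Code F n m} {u : ℕ} (hu : u ≤ n)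
    (hA : ∀ M ∈ A, M.rank ≤ u) (hdim : finrank F A = m * u) : IsAnticode A u := by
  have hopt : IsOptimal (homs A) u := by
    refine ⟨?_, by simpa using hu, by simpa [finrank_homs] using hdim⟩
    rintro _ ⟨M, hM, rfl⟩
    exact hA M hM
  obtain ⟨_, ⟨M, hM, rfl⟩, hrk⟩ := hopt.exists_rk_eq (by simpa using hm) (by simpa using hnm)
  have h : maxrk A = u := by
    refine le_antisymm ?_ ?_
    · obtain ⟨M', hM', h⟩ := exists_rank_eq_maxrk A
      exact h ▸ hA M' hM'
    · rw [← hrk]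
      exact rank_le_maxrk hM
  exact ⟨by rw [IsOptimalAnticode, h, hdim], h⟩

/-- The matrices with column space in `U`. -/
noncomputable def colAnticode (m : ℕ) (U : Submodule F (Fin n → F)) : Code F n m :=
  (homInto (Fin m → F) U).comap (Matrix.toLin' (R := F)).toLinearMap

theorem colAnticode_mono {U V : Submodule F (Fin n → F)} (h : U ≤ V) :
    colAnticode m U ≤ colAnticode m V := fun _ hM x => h (hM x)

theorem homs_colAnticode (U : Submodule F (Fin n → F)) :
    homs (colAnticode m U) = homInto (Fin m → F) U :=
  Submodule.map_comap_eq_of_surjective Matrix.toLin'.surjective _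

theorem isAnticode_colAnticode (hnm : n ≤ m) (hm : 0 < m) (U : Submodule F (Fin n → F)) :
    IsAnticode (colAnticode m U) (finrank F U) := by
  refine isAnticode_of_rank_le hnm hm (by simpa using Submodule.finrank_le U) ?_ ?_
  · intro M hM
    exact rk_le_of_mem_homInto hM
  · rw [← finrank_homs, homs_colAnticode, finrank_homInto]
    simp

theorem IsAnticode.transposeCode {A : Code F n n} (hn : 0 < n) {u : ℕ} (h : IsAnticode A u) :
    IsAnticode (transposeCode A) u := by
  refine isAnticode_of_rank_le le_rfl hn h.le ?_ ?_
  · intro M hM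
    rw [← Matrix.rank_transpose, ← h.2]
    exact rank_le_maxrk (mem_transposeCode.1 hM)
  · rw [finrank_transposeCode, h.finrank_eq]

theorem toMatrix'_smulRight (φ : Dual F (Fin m → F)) (x : Fin n → F) :
    LinearMap.toMatrix' (φ.smulRight x) = Matrix.vecMulVec x fun j => φ (Pi.single j 1) := by
  ext i j
  simp [LinearMap.toMatrix'_apply, Matrix.vecMulVec_apply, mul_comm]

theorem smulRight_mem_homs {A : Code F n m} {φ : Dual F (Fin m → F)} {x : Fin n → F} :
    φ.smulRight x ∈ homs A ↔ Matrix.vecMulVec x (fun j => φ (Pi.single j 1)) ∈ A := by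
  rw [← toMatrix'_smulRight, ← toLin'_mem_homs, Matrix.toLin'_toMatrix']

theorem IsAnticode.eq_colAnticode (hnm : n ≤ m) {A : Code F n m} {u : ℕ} (h : IsAnticode A u)
    (hfull : ∃ x : Fin n → F, x ≠ 0 ∧ ∀ w, Matrix.vecMulVec x w ∈ A) :
    ∃ U : Submodule F (Fin n → F), finrank F U = u ∧ A = colAnticode m U := by
  obtain ⟨x, hx, hxA⟩ := hfull
  have := h.isOptimal.eq_homInto_fullVectors (by simpa using hnm) ⟨x, hx, fun φ =>
    smulRight_mem_homs.2 (hxA _)⟩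
  refine ⟨_, this.1, ?_⟩
  ext M
  rw [← toLin'_mem_homs]
  exact SetLike.ext_iff.1 this.2 _

theorem IsAnticode.eq_colAnticode_or_full (hnm : n ≤ m) (hm : 0 < m) {A : Code F n m} {u : ℕ}
    (h : IsAnticode A u) :
    (∃ U : Submodule F (Fin n → F), finrank F U = u ∧ A = colAnticode m U) ∨
      (n = m ∧ ∃ w : Fin m → F, w ≠ 0 ∧ ∀ x, Matrix.vecMulVec x w ∈ A) := by
  rcases Nat.eq_zero_or_pos u with rfl | hu
  · left
    have h1 := (isAnticode_colAnticode hnm hm (⊥ : Submodule F (Fin n → F))).finrank_eq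
    rw [finrank_bot] at h1
    exact ⟨⊥, finrank_bot _ _,
      (Submodule.finrank_eq_zero.1 h.finrank_eq).trans (Submodule.finrank_eq_zero.1 h1).symm⟩
  rcases h.isOptimal.exists_smulRight_mem (by simpa using hnm) hu with
    ⟨x, hx, hfull⟩ | ⟨heq, φ, hφ, hfull⟩
  · left
    refine h.eq_colAnticode hnm ⟨x, hx, fun w => ?_⟩
    have hw : (fun j => (Pi.basisFun F (Fin m)).constr F w (Pi.single j 1)) = w :=
      funext fun j => by rw [← Pi.basisFun_apply F, Basis.constr_basis]
    exact hw ▸ smulRight_mem_homs.1 (hfull ((Pi.basisFun F (Fin m)).constr F w))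
  · right
    refine ⟨by simpa using heq, fun j => φ (Pi.single j 1), fun h0 => hφ ?_, fun x =>
      smulRight_mem_homs.1 (hfull x)⟩
    exact (Pi.basisFun F (Fin m)).ext fun j => by simpa using congrFun h0 j

/-- To prove a property of optimal anticodes that is invariant under transposition of square
matrices, it is enough to consider the spaces of all matrices with a given column space. -/
theorem IsAnticode.induction {P : ∀ {n m : ℕ}, Code F n m → ℕ → Prop} (hnm : n ≤ m) (hm : 0 < m)
    {A : Code F n m} {u : ℕ} (h : IsAnticode A u)
    (hcol : ∀ U : Submodule F (Fin n → F), P (colAnticode m U) (finrank F U))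
    (htr : ∀ A : Code F n n, 0 < n → P (RankMetric.transposeCode A) u → P A u) : P A u := by
  rcases h.eq_colAnticode_or_full hnm hm with ⟨U, rfl, rfl⟩ | ⟨rfl, w, hw, hfull⟩
  · exact hcol U
  · apply htr A hm
    obtain ⟨U, rfl, hA⟩ := (h.transposeCode hm).eq_colAnticode le_rfl ⟨w, hw, fun x => by
      rw [mem_transposeCode, Matrix.transpose_vecMulVec]
      exact hfull x⟩
    exact hA ▸ hcol U

theorem IsAnticode.exists_le (hnm : n ≤ m) (hm : 0 < m) {A : Code F n m} {u : ℕ}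
    (h : IsAnticode A u) {v : ℕ} (hv : v ≤ u) : ∃ A' ≤ A, IsAnticode A' v := by
  refine h.induction (P := fun {n m} (A : Code F n m) u => v ≤ u → ∃ A' ≤ A, IsAnticode A' v)
    hnm hm ?_ ?_ hv
  · intro U hv
    obtain ⟨V, -, hVU, rfl⟩ := exists_finrank_eq_of_le_of_le (bot_le : ⊥ ≤ U)
      (k := v) (by simp) hv
    exact ⟨_, colAnticode_mono hVU, isAnticode_colAnticode hnm hm V⟩
  · intro A hn ih hv
    obtain ⟨A', hA', h'⟩ := ih hv
    exact ⟨_, transposeCode_transposeCode A ▸ transposeCode_mono hA', h'.transposeCode hn⟩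

theorem IsAnticode.exists_ge (hnm : n ≤ m) (hm : 0 < m) {A : Code F n m} {u : ℕ}
    (h : IsAnticode A u) {v : ℕ} (huv : u ≤ v) (hv : v ≤ n) : ∃ A' ≥ A, IsAnticode A' v := by
  refine h.induction
    (P := fun {n m} (A : Code F n m) u => u ≤ v → v ≤ n → ∃ A' ≥ A, IsAnticode A' v)
    hnm hm ?_ ?_ huv hv
  · intro U huv hv
    obtain ⟨V, hUV, -, rfl⟩ := exists_finrank_eq_of_le_of_le (le_top : U ≤ ⊤)
      (k := v) huv (by simpa using hv)
    exact ⟨_, colAnticode_mono hUV, isAnticode_colAnticode hnm hm V⟩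
  · intro A hn ih huv hv
    obtain ⟨A', hA', h'⟩ := ih huv hv
    exact ⟨_, transposeCode_transposeCode A ▸ transposeCode_mono hA', h'.transposeCode hn⟩

/-- The anticode contains x wᵀ for all x in U and all w, and orthogonality to these means that xᵀN =
0, so U lies in the kernel of Nᵀ. -/
theorem rank_le_of_mem_dual_colAnticode {U : Submodule F (Fin n → F)}
    {N : Matrix (Fin n) (Fin m) F} (hN : N ∈ dual (colAnticode m U)) :
    N.rank ≤ n - finrank F U := by
  have hker : U ≤ LinearMap.ker N.transpose.mulVecLin := by
    intro x hx
    rw [LinearMap.mem_ker, Matrix.mulVecLin_apply, Matrix.mulVec_transpose]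
    refine dotProduct_eq_zero_iff.1 fun w => ?_
    rw [← trace_mul_transpose_vecMulVec]
    refine hN _ fun y => ?_
    change (Matrix.vecMulVec x w).mulVec y ∈ U
    rw [Matrix.vecMulVec_mulVec, op_smul_eq_smul]
    exact U.smul_mem _ hx
  have h1 := Submodule.finrank_mono hker
  have h2 := LinearMap.finrank_range_add_finrank_ker N.transpose.mulVecLin
  have h3 : finrank F (LinearMap.range N.transpose.mulVecLin) = N.rank := N.rank_transpose
  simp only [finrank_fintype_fun_eq_card, Fintype.card_fin] at h2
  omega

/-- The dual of an optimal anticode is an optimal anticode. -/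
theorem IsAnticode.dual (hnm : n ≤ m) (hm : 0 < m) {A : Code F n m} {u : ℕ}
    (h : IsAnticode A u) : IsAnticode (dual A) (n - u) := by
  refine h.induction
    (P := fun {n m} (A : Code F n m) u => IsAnticode (RankMetric.dual A) (n - u)) hnm hm ?_ ?_
  · intro U
    have hU : finrank F U ≤ n := by simpa using Submodule.finrank_le U
    refine isAnticode_of_rank_le hnm hm (Nat.sub_le _ _)
      (fun N hN => rank_le_of_mem_dual_colAnticode hN) ?_
    have h1 := finrank_add_finrank_dual (colAnticode m U)
    rw [(isAnticode_colAnticode hnm hm U).finrank_eq, mul_comm n] at h1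
    rw [Nat.mul_sub]
    omega
  · intro A hn ih
    rw [dual_transposeCode] at ih
    exact transposeCode_transposeCode (RankMetric.dual A) ▸ ih.transposeCode hn

theorem exists_isAnticode_mem (hnm : n ≤ m) (hm : 0 < m) (M : Matrix (Fin n) (Fin m) F) :
    ∃ A : Code F n m, IsAnticode A M.rank ∧ M ∈ A :=
  ⟨_, isAnticode_colAnticode hnm hm (LinearMap.range M.mulVecLin),
    fun x => LinearMap.mem_range_self M.mulVecLin x⟩

end Anticodes

/-! ### Generalized weights and the minimum distance of the dual code. -/

section Weights

variable {F : Type*} [Field F] [Finite F] {n m : ℕ}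

theorem minDist_le_rank {C : Code F n m} {A : Matrix (Fin n) (Fin m) F} (hA : A ∈ C)
    (hA0 : A ≠ 0) : minDist C ≤ A.rank :=
  Nat.sInf_le ⟨A, hA, hA0, rfl⟩

theorem exists_rank_eq_minDist {C : Code F n m} (hC : C ≠ ⊥) :
    ∃ A ∈ C, A ≠ 0 ∧ A.rank = minDist C := by
  obtain ⟨A, hA, hA0⟩ := Submodule.exists_mem_ne_zero_of_ne_bot hC
  exact Nat.sInf_mem (s := {r : ℕ | ∃ A ∈ C, A ≠ 0 ∧ A.rank = r}) ⟨_, A, hA, hA0, rfl⟩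

theorem minDist_pos {C : Code F n m} (hC : C ≠ ⊥) : 1 ≤ minDist C := by
  obtain ⟨A, -, hA0, h⟩ := exists_rank_eq_minDist hC
  refine Nat.pos_of_ne_zero fun h0 => hA0 ?_
  have : rk A.toLin' = 0 := h.trans h0
  simpa using rk_eq_zero_iff.1 this

theorem minDist_le_iff (hnm : n ≤ m) (hm : 0 < m) {C : Code F n m} (hC : C ≠ ⊥) {s : ℕ}
    (hs : s ≤ n) :
    minDist C ≤ s ↔ ∃ A : Code F n m, IsAnticode A s ∧ 1 ≤ finrank F (C ⊓ A : Code F n m) := by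
  constructor
  · intro h
    obtain ⟨M, hM, hM0, hrk⟩ := exists_rank_eq_minDist hC
    obtain ⟨A, hA, hMA⟩ := exists_isAnticode_mem hnm hm M
    obtain ⟨A', hA', h'⟩ := hA.exists_ge hnm hm (hrk.trans_le h) hs
    refine ⟨A', h', Nat.pos_of_ne_zero fun h0 => hM0 ?_⟩
    have : M ∈ C ⊓ A' := ⟨hM, hA' hMA⟩
    rwa [Submodule.finrank_eq_zero.1 h0, Submodule.mem_bot] at this
  · rintro ⟨A, hA, h1⟩
    obtain ⟨M, hM, hM0⟩ := Submodule.exists_mem_ne_zero_of_ne_bot (p := C ⊓ A) (by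
      rintro h
      rw [h, finrank_bot] at h1
      omega)
    exact (minDist_le_rank hM.1 hM0).trans (hA.2 ▸ rank_le_maxrk hM.2)

theorem isAnticode_top (hnm : n ≤ m) (hm : 0 < m) : IsAnticode (⊤ : Code F n m) n :=
  isAnticode_of_rank_le hnm hm le_rfl (fun M _ => M.rank_le_height) (by
    rw [finrank_top, Module.finrank_matrix]
    simp [mul_comm])

/-- Smaller anticodes extend to maximal rank s, so only those of maximal rank exactly s need be
tested. In this form the condition can be dualized. -/
theorem genWeight_le_iff (hnm : n ≤ m) (hm : 0 < m) {C : Code F n m} {r s : ℕ}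
    (hr : r ≤ finrank F C) (hs : s ≤ n) :
    genWeight C r ≤ s ↔
      ∃ A : Code F n m, IsAnticode A s ∧ r ≤ finrank F (C ⊓ A : Code F n m) := by
  constructor
  · intro h
    obtain ⟨A, hA, hrA, hk⟩ := Nat.sInf_mem (s := {k : ℕ | ∃ A : Code F n m,
      IsOptimalAnticode A ∧ r ≤ finrank F (C ⊓ A : Code F n m) ∧ maxrk A = k})
      ⟨n, ⊤, (isAnticode_top hnm hm).1, by rwa [inf_top_eq], (isAnticode_top hnm hm).2⟩
    have hA' : IsAnticode A (genWeight C r) := ⟨hA, hk⟩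
    obtain ⟨A', hle, hA'⟩ := hA'.exists_ge hnm hm h hs
    exact ⟨A', hA', hrA.trans (Submodule.finrank_mono (inf_le_inf_left _ hle))⟩
  · rintro ⟨A, hA, hrA⟩
    exact Nat.sInf_le ⟨A, hA.1, hrA, hA.2⟩

theorem genWeight_le (hnm : n ≤ m) (hm : 0 < m) {C : Code F n m} {r : ℕ}
    (hr : r ≤ finrank F C) : genWeight C r ≤ n :=
  (genWeight_le_iff hnm hm hr le_rfl).2 ⟨⊤, isAnticode_top hnm hm, by rwa [inf_top_eq]⟩

theorem genWeight_one (hnm : n ≤ m) (hm : 0 < m) {C : Code F n m} (hC : C ≠ ⊥) :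
    genWeight C 1 = minDist C := by
  have h1 : 1 ≤ finrank F C :=
    Nat.pos_of_ne_zero fun h => hC (Submodule.finrank_eq_zero.1 h)
  have hd : minDist C ≤ n := by
    obtain ⟨A, -, -, h⟩ := exists_rank_eq_minDist hC
    exact h ▸ A.rank_le_height
  refine le_antisymm ?_ ?_
  · rw [genWeight_le_iff hnm hm h1 hd, ← minDist_le_iff hnm hm hC hd]
  · rw [minDist_le_iff hnm hm hC (genWeight_le hnm hm h1),
      ← genWeight_le_iff hnm hm h1 (genWeight_le hnm hm h1)]

/-- Duality between the minimum distance of the dual code and the generalized weights. -/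
theorem minDist_dual_le_iff (hnm : n ≤ m) (hm : 0 < m) {C : Code F n m} {k : ℕ}
    (hk : finrank F C = k * m) (hC1 : C ≠ ⊤) {s : ℕ} (hs : 1 ≤ s) (hsk : s ≤ k) (hkn : k ≤ n) :
    minDist (dual C) ≤ s ↔ genWeight C (1 + (k - s) * m) ≤ n - s := by
  have hD : dual C ≠ ⊥ := by
    intro h
    have h1 := finrank_add_finrank_dual C
    rw [h, finrank_bot] at h1
    refine hC1 (Submodule.eq_top_of_finrank_eq ?_)
    rw [Module.finrank_matrix]
    simpa using h1
  have hr : 1 + (k - s) * m ≤ finrank F C := by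
    obtain ⟨j, rfl⟩ := Nat.exists_eq_add_of_le hsk
    obtain ⟨i, rfl⟩ := Nat.exists_eq_add_of_le hs
    rw [hk, Nat.add_sub_cancel_left]
    nlinarith
  rw [minDist_le_iff hnm hm hD (hsk.trans hkn), genWeight_le_iff hnm hm hr (Nat.sub_le _ _)]
  -- The dimension of the intersection of the duals of C and A is dim(C ⊓ A) - (k - s)m.
  have key : ∀ A : Code F n m, IsAnticode A (n - s) →
      (1 ≤ finrank F (dual C ⊓ dual A : Code F n m) ↔
        1 + (k - s) * m ≤ finrank F (C ⊓ A : Code F n m)) := by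
    intro A hA
    have h1 := finrank_dual_inf_dual C A
    rw [hk, hA.finrank_eq] at h1
    obtain ⟨j, rfl⟩ := Nat.exists_eq_add_of_le hsk
    obtain ⟨i, rfl⟩ := Nat.exists_eq_add_of_le hkn
    rw [show s + j + i - s = j + i by omega] at h1
    rw [show s + j - s = j by omega]
    have h2 : (s + j + i) * m + j * m = (s + j) * m + m * (j + i) := by ring
    omega
  constructor
  · rintro ⟨A, hA, h⟩
    refine ⟨dual A, hA.dual hnm hm, (key _ (hA.dual hnm hm)).1 ?_⟩
    rwa [dual_dual]
  · rintro ⟨A, hA, h⟩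
    have h1 := hA.dual hnm hm
    rw [Nat.sub_sub_self (hsk.trans hkn)] at h1
    exact ⟨dual A, h1, (key A hA).2 h⟩

/-- An optimal anticode of maximal rank n + 1 - s has codimension (s - 1)m, so it meets C in
dimension at least (k + 1 - s)m, which is at least 1 + (k - s)m. -/
theorem genWeight_le_of_finrank_eq (hnm : n ≤ m) (hm : 0 < m) {C : Code F n m} {k : ℕ}
    (hk : finrank F C = k * m) {s : ℕ} (hs : 1 ≤ s) (hsk : s ≤ k) (hkn : k ≤ n) :
    genWeight C (1 + (k - s) * m) ≤ n + 1 - s := by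
  have hr : 1 + (k - s) * m ≤ (k + 1 - s) * m := by
    obtain ⟨j, rfl⟩ := Nat.exists_eq_add_of_le hsk
    rw [show s + j + 1 - s = j + 1 by omega, show s + j - s = j by omega]
    nlinarith
  have hr' : (k + 1 - s) * m ≤ finrank F C := hk ▸ Nat.mul_le_mul_right m (by omega)
  rw [genWeight_le_iff hnm hm (hr.trans hr') (by omega)]
  obtain ⟨A, -, hA⟩ := (isAnticode_top (F := F) hnm hm).exists_le hnm hm
    (v := n + 1 - s) (by omega)
  refine ⟨A, hA, hr.trans ?_⟩
  have h1 := Submodule.finrank_sup_add_finrank_inf_eq C A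
  have h2 := Submodule.finrank_le (C ⊔ A)
  rw [Module.finrank_matrix] at h2
  simp only [Fintype.card_fin, finrank_self, mul_one] at h2
  rw [hk, hA.finrank_eq] at h1
  obtain ⟨j, rfl⟩ := Nat.exists_eq_add_of_le hsk
  obtain ⟨i, rfl⟩ := Nat.exists_eq_add_of_le hkn
  rw [show s + j + i + 1 - s = j + i + 1 by omega] at h1
  rw [show s + j + 1 - s = j + 1 by omega]
  have h3 : (s + j + i) * m + (j + 1) * m = (s + j) * m + m * (j + i + 1) := by ring
  omega

theorem rdef_of_finrank_eq (hm : 0 < m) {C : Code F n m} {k : ℕ} (hk : finrank F C = k * m) :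
    rdef C = n - k + 1 - minDist C := by
  have : (m : ℚ) ≠ 0 := by exact_mod_cast hm.ne'
  rw [rdef, hk, Nat.cast_mul, mul_div_cancel_right₀ _ this, Int.ceil_natCast]

end Weights

end RankMetric

/-! ### The characterization of dually AMRD codes. -/

theorem mainTheorem4 {F : Type*} [Field F] [Finite F] {n m : ℕ} (hnm : n ≤ m)
    (C : RankMetric.Code F n m) (hC0 : C ≠ ⊥) (hC1 : C ≠ ⊤)
    (t : ℕ) (ht : Module.finrank F C = t) (hmt : m ∣ t) :
    (RankMetric.genWeight C (1 + (⌈(t : ℚ) / (m : ℚ)⌉₊ - 1) * m) = n →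
      (1 ≤ RankMetric.rdef C →
        (RankMetric.IsAMRD (RankMetric.dual C) ↔
          (RankMetric.genWeight C (1 + m) : ℤ) =
            (RankMetric.minDist C : ℤ) + RankMetric.rdef C + 1)) ∧
      (RankMetric.IsAMRD C →
        (RankMetric.IsDuallyAMRD C ↔
          RankMetric.genWeight C (1 + m) = RankMetric.minDist C + 2))) ∧
    (RankMetric.genWeight C (1 + (⌈(t : ℚ) / (m : ℚ)⌉₊ - 1) * m) < n →
      (RankMetric.IsAMRD (RankMetric.dual C) ↔ ⌈(t : ℚ) / (m : ℚ)⌉₊ = 1)) ∧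
    ((RankMetric.IsDuallyAMRD C ∧ (t : ℚ) / (m : ℚ) = 1) ↔
      (RankMetric.genWeight C (1 + (⌈(t : ℚ) / (m : ℚ)⌉₊ - 1) * m) < n ∧
        (RankMetric.minDist C : ℤ) = (n : ℤ) - 1)) := by
  have ht0 : t ≠ 0 := fun h => hC0 (Submodule.finrank_eq_zero.1 (ht.trans h))
  obtain ⟨k, rfl⟩ := hmt
  rw [mul_comm] at ht ht0
  have hm : 0 < m := Nat.pos_of_ne_zero fun h => ht0 (by rw [h, mul_zero])
  have hk : 1 ≤ k := Nat.pos_of_ne_zero fun h => ht0 (by rw [h, zero_mul])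
  have hsum := RankMetric.finrank_add_finrank_dual C
  have hD : RankMetric.dual C ≠ ⊥ := by
    intro h
    rw [h, finrank_bot] at hsum
    refine hC1 (Submodule.eq_top_of_finrank_eq ?_)
    rw [Module.finrank_matrix]
    simpa using hsum
  have hkn : k < n := by
    have h1 : Module.finrank F (RankMetric.dual C) ≠ 0 := fun h =>
      hD (Submodule.finrank_eq_zero.1 h)
    rw [ht] at hsum
    exact Nat.lt_of_mul_lt_mul_right (a := m) (by omega)
  have hdual : Module.finrank F (RankMetric.dual C) = (n - k) * m := by
    rw [Nat.sub_mul]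
    omega
  have hrdef := RankMetric.rdef_of_finrank_eq hm ht
  have hrdefD := RankMetric.rdef_of_finrank_eq hm hdual
  rw [Nat.cast_sub hkn.le] at hrdefD
  have hquot : ((m * k : ℕ) : ℚ) / (m : ℚ) = k := by
    have : (m : ℚ) ≠ 0 := by exact_mod_cast hm.ne'
    rw [Nat.cast_mul, mul_div_cancel_left₀ _ this]
  have hDpos := RankMetric.minDist_pos hD
  have hlast := RankMetric.minDist_dual_le_iff hnm hm ht hC1 le_rfl hk hkn.le
  have hfirst := RankMetric.minDist_dual_le_iff hnm hm ht hC1 hk le_rfl hkn.le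
  rw [Nat.sub_self, zero_mul, add_zero, RankMetric.genWeight_one hnm hm hC0] at hfirst
  rw [hquot, Nat.ceil_natCast, Nat.cast_eq_one]
  have hpart : RankMetric.genWeight C (1 + (k - 1) * m) = n → 1 ≤ RankMetric.rdef C →
      (RankMetric.rdef (RankMetric.dual C) = 1 ↔
        (RankMetric.genWeight C (1 + m) : ℤ) =
          (RankMetric.minDist C : ℤ) + RankMetric.rdef C + 1) := by
    intro hn hdef
    -- For k = 1 the weight assumed equal to n is a_1 = d, and then the defect of C is 0.
    have hk2 : 2 ≤ k := by
      by_contra h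
      obtain rfl : k = 1 := by omega
      rw [Nat.sub_self, zero_mul, add_zero, RankMetric.genWeight_one hnm hm hC0] at hn
      omega
    -- `hfirst` and positive defect give d' ≤ k. As d + rdef(C) + 1 = n - k + 2 bounds a_{1+m} from
    -- above, equality holds exactly when d' ≤ k - 1 fails.
    have h1 := RankMetric.minDist_dual_le_iff hnm hm ht hC1 (s := k - 1) (by omega) (by omega)
      hkn.le
    have h2 := RankMetric.genWeight_le_of_finrank_eq hnm hm ht (s := k - 1) (by omega) (by omega)
      hkn.le
    rw [Nat.sub_sub_self hk, one_mul] at h1 h2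
    omega
  unfold RankMetric.IsDuallyAMRD RankMetric.IsAMRD RankMetric.IsAlmostMRD
  -- In the second claim a weight below n means d' = 1 by `hlast`, so the dual has defect k.
  refine ⟨fun hn => ⟨hpart hn, fun hC => ?_⟩, fun hn => by omega, ?_⟩
  · have := hpart hn hC.ge
    omega
  · constructor
    · rintro ⟨⟨h1, h2⟩, rfl⟩
      omega
    · rintro ⟨h1, h2⟩
      -- Here d' = 1 ≤ k, so `hfirst` gives n - 1 = d ≤ n - k.
      have hk1 : k = 1 := by omega
      omega
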